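/- **Setting.** Let $\Lambda(k),\Omega(k)$ be $N\times N$ matrix polynomials in the spectral parameter $k$ which commute with each other (for example, diagonal ones), and put $E(k)=E(k,x,t)=\exp\{-\Lambda(k)x-\Omega(k)t\}$, $x,t\in\mathbb R$. Let $(k_1,\bar k_1),\dots,(k_{N_Z},\bar k_{N_Z})$ be pairs of complex numbers, the $k_n$ distinct, the $\bar k_n$ distinct, and $k_m\neq\bar k_n$ for all $m,n$ (the bar need not be complex conjugation). To the $n$-th pair belong a geometric multiplicity $r_1^{(n)}\ge 1$ and a block sequence $s^{(n)}_1\ge\dots\ge s^{(n)}_{r_1^{(n)}}\ge 1$. Enumerate all blocks of all pairs by $\nu$, and let $s_\nu$ be the size of block $\nu$ and $(\kappa_\nu,\bar\kappa_\nu)$ the pair to which it belongs. *$p$-vectors* are columns $|p^{(\nu)}_i\rangle\in\mathbb C^N$ and rows $\langle\bar p^{(\nu)}_i|$, $1\le i\le s_\nu$; let $P$ be the matrix with the columns $|p_i^{(\nu)}\rangle$ and $\bar P$ the matrix with the rows $\langle\bar p_i^{(\nu)}|$. Let $\mathcal D(k)$, $\overline{\mathcal D}(k)$ be the block-diagonal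 matrices with blocks $$(D_\nu(k))_{\alpha\beta}=\begin{cases}(k-\kappa_\nu)^{-(\beta-\alpha+1)},&\alpha\le\beta,\\0,&\alpha>\beta,\end{cases}\qquad(\bar D_\nu(k))_{\alpha\beta}=\begin{cases}(k-\bar\kappa_\nu)^{-(\alpha-\beta+1)},&\beta\le\alpha,\\0,&\beta>\alpha.\end{cases}$$ Let $\overline{\mathcal K}$, $\mathcal K$ be the matrices with blocks $$\bar K^{(\nu,\mu)}=\sum_{j=0}^{s_\nu-1}\sum_{l=0}^{s_\mu-1}\frac{(-1)^l(j+l)!}{j!\,l!}\frac{H_{-j}\bar Q_l^{(\nu,\mu)}}{(\kappa_\mu-\bar\kappa_\nu)^{j+l+1}},\qquad K^{(\nu,\mu)}=\sum_{l=0}^{s_\nu-1}\sum_{j=0}^{s_\mu-1}\frac{(-1)^l(l+j)!}{l!\,j!}\frac{Q_l^{(\nu,\mu)}H_j}{(\bar\kappa_\nu-\kappa_\mu)^{l+j+1}},$$ where $(H_j)_{\alpha\beta}=\delta_{\alpha,\beta-j}$, $\bar Q_l^{(\nu,\mu)}$ is the matrix $(\langle\bar p^{(\nu)}_\alpha|p^{(\mu)}_\beta\rangle)_{\alpha\beta}$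 shifted $l$ columns to the right, and $Q_l^{(\nu,\mu)}$ is the same matrix shifted $l$ rows down (vacated entries are $0$). The vectors are *$p$-vectors of* a soliton matrix $\Gamma(k)$ if $\mathcal K,\overline{\mathcal K}$ are non-degenerate and, away from the poles, $$\Gamma(k)=I-P\,\overline{\mathcal K}^{-1}\overline{\mathcal D}(k)\bar P,\qquad \Gamma^{-1}(k)=I-P\,\mathcal D(k)\mathcal K^{-1}\bar P .$$ For a matrix function $F(k)$ let $\mathbf F_\nu(k)$ be the lower-triangular block-Toeplitz matrix with $s_\nu\times s_\nu$ blocks whose $(i,j)$ block is $\frac1{(i-j)!}\frac{d^{i-j}F}{dk^{i-j}}$ for $i\ge j$ and $0$ otherwise, and $\overline{\mathbf F}_\nu(k)$ the upper-triangular one with $(i,j)$ block $\frac1{(j-i)!}\frac{d^{j-i}F}{dk^{j-i}}$ for $i\le j$; write $\mathbf\Gamma_\nu,\mathbf\Lambda_\nu,\mathbf\Omega_\nu$ for $F=\Gamma,\Lambda,\Omega$, and $\overline{\mathbf\Gamma}_\nu,\overline{\mathbf\Lambda}_\nu,\overline{\mathbf\Omega}_\nu$ for $F=\Gamma^{-1},\Lambda,\Omega$.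 Write $\mathbf p_\nu$ for the stacked column $(|p_1^{(\nu)}\rangle,\dots,|p_{s_\nu}^{(\nu)}\rangle)^T$ and $\bar{\mathbf p}_\nu=(\langle\bar p_1^{(\nu)}|,\dots,\langle\bar p_{s_\nu}^{(\nu)}|)$. *Invariance transformations* are $P\mapsto PB$, $\bar P\mapsto\bar B\bar P$ with non-degenerate matrices $B,\bar B$ (which may depend on $x,t$) such that $B$ commutes with $\mathcal D(k)$ and $\bar B$ with $\overline{\mathcal D}(k)$ for all $k$ off the poles. Let $\Gamma(k,x,t)$, $(x,t)\in\mathbb R^2$, be a family of soliton matrices with these zeros and blocks (that is, $\Gamma(\cdot,x,t)$ has $p$-vectors for each $(x,t)$), which satisfies $$\partial_x\Gamma=\Gamma\Lambda+U\Gamma,\qquad\partial_t\Gamma=\Gamma\Omega+V\Gamma$$ away from the points $\bar k_n$, with potentials $U(k,x,t),V(k,x,t)$ polynomial in $k$. **Theorem.** 1. *(Derived equations.)* All $p$-vectors of $\Gamma$ that are differentiable in $x$ and in $t$ satisfy $$\mathbf\Gamma_\nu(\kappa_\nu)\{[\partial_x+\mathbf\Lambda_\nu(\kappa_\nu)]\mathbf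 p_\nu\}=0,\qquad\mathbf\Gamma_\nu(\kappa_\nu)\{[\partial_t+\mathbf\Omega_\nu(\kappa_\nu)]\mathbf p_\nu\}=0,$$ $$\{\partial_x\bar{\mathbf p}_\nu-\bar{\mathbf p}_\nu\overline{\mathbf\Lambda}_\nu(\bar\kappa_\nu)\}\overline{\mathbf\Gamma}_\nu(\bar\kappa_\nu)=0,\qquad\{\partial_t\bar{\mathbf p}_\nu-\bar{\mathbf p}_\nu\overline{\mathbf\Omega}_\nu(\bar\kappa_\nu)\}\overline{\mathbf\Gamma}_\nu(\bar\kappa_\nu)=0 .$$ 2. *(Evolution.)* Vectors $\mathbf p_\nu(x,t),\bar{\mathbf p}_\nu(x,t)$ are differentiable in $x$ and in $t$ and make the expressions in braces all vanish, for all $\nu$, $x$, $t$, if and only if there are constant vectors, marked by the subscript $0$, with $$\mathbf p_\nu=\exp\{-\mathbf\Lambda_\nu(\kappa_\nu)x-\mathbf\Omega_\nu(\kappa_\nu)t\}\,\mathbf p_{0\nu},\qquad \bar{\mathbf p}_\nu=\bar{\mathbf p}_{0\nu}\exp\{\overline{\mathbf\Lambda}_\nu(\bar\kappa_\nu)x+\overline{\mathbf\Omega}_\nu(\bar\kappa_\nu)t\};\tag{$*$}$$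 this holds for the $|p\rangle$- and for the $\langle\bar p|$-vectors separately. 3. *(No loss of generality.)* Let $\mathbf p_{0\nu},\bar{\mathbf p}_{0\nu}$ be any $p$-vectors of $\Gamma(\cdot,0,0)$. Then the vectors $(*)$ are $p$-vectors of $\Gamma(\cdot,x,t)$ for all $(x,t)$, and any other $p$-vectors of $\Gamma(\cdot,x,t)$ arise from them by an invariance transformation. Moreover, let $\tilde{\mathbf p}_\nu(x,t),\bar{\tilde{\mathbf p}}_\nu(x,t)$ be any vectors, differentiable in $x$ and in $t$, that solve the derived equations in 1, satisfy $\mathbf\Gamma_\nu(\kappa_\nu)\tilde{\mathbf p}_\nu=0$ and $\bar{\tilde{\mathbf p}}_\nu\overline{\mathbf\Gamma}_\nu(\bar\kappa_\nu)=0$ at $(x,t)=(0,0)$, and whose matrices $\mathcal K,\overline{\mathcal K}$ are non-degenerate for all $(x,t)$. Then at each $(x,t)$ they arise from the vectors $(*)$ by an invariance transformation, and they are $p$-vectors of $\Gamma(\cdot,x,t)$, i.e. give the same soliton matrix. 4. *(The exponentials.)* $\exp\{-\mathbf\Lambda_\nu(\kappa_\nu)x-\mathbf\Omega_\nu(\kappa_\nu)t\}=\mathbf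 E_\nu(\kappa_\nu)$, the lower-triangular block-Toeplitz matrix formed from $E(k)$ at $k=\kappa_\nu$, and $\exp\{\overline{\mathbf\Lambda}_\nu(\bar\kappa_\nu)x+\overline{\mathbf\Omega}_\nu(\bar\kappa_\nu)t\}$ is the upper-triangular block-Toeplitz matrix formed from $E^{-1}(k)$ at $k=\bar\kappa_\nu$. -/

import Mathlib

open Polynomial

namespace Soliton

/-- The discrete spectrum of a soliton matrix with `NZ` pairs of normal zeros `(k n, kbar n)`:
`r n` is the geometric multiplicity of the `n`-th pair and `s n` its block sequence
`s n 0 ≥ s n 1 ≥ …` of positive integers. -/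
structure ZeroData where
  /-- number of pairs of zeros -/
  NZ : ℕ
  /-- zeros in the domain `C₊` -/
  k : Fin NZ → ℂ
  /-- zeros in the domain `C₋` -/
  kbar : Fin NZ → ℂ
  k_injective : Function.Injective k
  kbar_injective : Function.Injective kbar
  k_ne_kbar : ∀ m n, k m ≠ kbar n
  /-- geometric multiplicities -/
  r : Fin NZ → ℕ
  r_pos : ∀ n, 0 < r n
  /-- block sequences -/
  s : (n : Fin NZ) → Fin (r n) → ℕ
  s_pos : ∀ n ν, 0 < s n ν
  s_antitone : ∀ n, Antitone (s n)

/-- The value at `z` of a matrix whose entries are polynomials in the spectral parameter. -/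
noncomputable def evalM {N : ℕ} (A : Matrix (Fin N) (Fin N) ℂ[X]) (z : ℂ) :
    Matrix (Fin N) (Fin N) ℂ :=
  A.map (Polynomial.eval z)

/-- Lower-triangular block-Toeplitz matrix with `s × s` blocks: the block in position `(i, j)`,
`j ≤ i`, is the `(i - j)`-th derivative of `F` at `z` divided by `(i - j)!`. -/
noncomputable def lowerToeplitz {N : ℕ} (s : ℕ) (F : ℂ → Matrix (Fin N) (Fin N) ℂ) (z : ℂ) :
    Matrix (Fin s × Fin N) (Fin s × Fin N) ℂ :=
  Matrix.of fun i j =>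
    if j.1 ≤ i.1 then
      iteratedDeriv (i.1.val - j.1.val) (fun w => F w i.2 j.2) z
        / ((i.1.val - j.1.val).factorial : ℂ)
    else 0

/-- Upper-triangular block-Toeplitz matrix with `s × s` blocks: the block in position `(i, j)`,
`i ≤ j`, is the `(j - i)`-th derivative of `F` at `z` divided by `(j - i)!`. -/
noncomputable def upperToeplitz {N : ℕ} (s : ℕ) (F : ℂ → Matrix (Fin N) (Fin N) ℂ) (z : ℂ) :
    Matrix (Fin s × Fin N) (Fin s × Fin N) ℂ :=
  Matrix.of fun i j =>
    if i.1 ≤ j.1 then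
      iteratedDeriv (j.1.val - i.1.val) (fun w => F w i.2 j.2) z
        / ((j.1.val - i.1.val).factorial : ℂ)
    else 0

/-- `E(z) = exp(-Λ(z) x - Ω(z) t)`. -/
noncomputable def expE {N : ℕ} (lam om : Matrix (Fin N) (Fin N) ℂ[X]) (x t : ℝ) (z : ℂ) :
    Matrix (Fin N) (Fin N) ℂ :=
  NormedSpace.exp (-((x : ℂ) • evalM lam z) - (t : ℂ) • evalM om z)

/-- The Toeplitz basis matrices, `(H_j)_{αβ} = δ_{α, β - j}`. -/
def toeplitzH (s : ℕ) (j : ℤ) : Matrix (Fin s) (Fin s) ℂ :=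
  Matrix.of fun α β => if (α.val : ℤ) = (β.val : ℤ) - j then 1 else 0

namespace ZeroData

variable (D : ZeroData) {N : ℕ}

/-- The `ν`-blocks, of all pairs of zeros. -/
abbrev Block : Type := Σ n : Fin D.NZ, Fin (D.r n)

/-- The zero `κ_ν` to which the block `ν` belongs. -/
def κ (ν : D.Block) : ℂ := D.k ν.1

/-- The zero `κ̄_ν` to which the block `ν` belongs. -/
def κbar (ν : D.Block) : ℂ := D.kbar ν.1

/-- The size `s_ν` of the block `ν`. -/
abbrev size (ν : D.Block) : ℕ := D.s ν.1 ν.2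

/-- The indices `(ν, i)` of the `p`-vectors; `i` counts from `0`. -/
abbrev Idx : Type := Σ ν : D.Block, Fin (D.size ν)

/-- A system of vectors of length `N`, one for each index. It stands for the columns
`|p_i^{(ν)}⟩` as well as for the rows `⟨p̄_i^{(ν)}|`. -/
abbrev Vecs (N : ℕ) : Type := D.Idx → Fin N → ℂ

variable {D}

/-- The matrix whose columns are the vectors `p`. -/
def cols (p : D.Vecs N) : Matrix (Fin N) D.Idx ℂ := Matrix.of fun a i => p i a

/-- The matrix whose rows are the vectors `pbar`. -/
def rows (pbar : D.Vecs N) : Matrix D.Idx (Fin N) ℂ := Matrix.of fun i a => pbar i a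

/-- The vectors of the block `ν`, stacked into one vector of length `s_ν N`. -/
def stack (ν : D.Block) (p : D.Vecs N) : Fin (D.size ν) × Fin N → ℂ := fun j => p ⟨ν, j.1⟩ j.2

variable (D)

/-- The block-diagonal matrix of the upper-triangular Toeplitz matrices `D_ν(z)`. -/
noncomputable def poleD (z : ℂ) : Matrix D.Idx D.Idx ℂ :=
  Matrix.blockDiagonal' fun ν : D.Block =>
    Matrix.of fun α β : Fin (D.size ν) =>
      if α ≤ β then 1 / (z - D.κ ν) ^ (β.val - α.val + 1) else 0

/-- The block-diagonal matrix of the lower-triangular Toeplitz matrices `D̄_ν(z)`. -/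
noncomputable def poleDbar (z : ℂ) : Matrix D.Idx D.Idx ℂ :=
  Matrix.blockDiagonal' fun ν : D.Block =>
    Matrix.of fun α β : Fin (D.size ν) =>
      if β ≤ α then 1 / (z - D.κbar ν) ^ (α.val - β.val + 1) else 0

variable {D}

/-- The matrix `Q̄_l^{(ν,μ)}`: the products `⟨p̄_α^{(ν)}|p_β^{(μ)}⟩`, shifted by `l` columns to the
right. -/
def innerQbar (p pbar : D.Vecs N) (ν μ : D.Block) (l : ℕ) :
    Matrix (Fin (D.size ν)) (Fin (D.size μ)) ℂ :=
  Matrix.of fun α β =>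
    if l ≤ β.val then
      pbar ⟨ν, α⟩ ⬝ᵥ p ⟨μ, ⟨β.val - l, lt_of_le_of_lt (Nat.sub_le _ _) β.isLt⟩⟩
    else 0

/-- The matrix `Q_l^{(ν,μ)}`: the products `⟨p̄_α^{(ν)}|p_β^{(μ)}⟩`, shifted by `l` rows down. -/
def innerQ (p pbar : D.Vecs N) (ν μ : D.Block) (l : ℕ) :
    Matrix (Fin (D.size ν)) (Fin (D.size μ)) ℂ :=
  Matrix.of fun α β =>
    if l ≤ α.val then
      pbar ⟨ν, ⟨α.val - l, lt_of_le_of_lt (Nat.sub_le _ _) α.isLt⟩⟩ ⬝ᵥ p ⟨μ, β⟩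
    else 0

/-- The block `K̄^{(ν,μ)}`. -/
noncomputable def blockKbar (p pbar : D.Vecs N) (ν μ : D.Block) :
    Matrix (Fin (D.size ν)) (Fin (D.size μ)) ℂ :=
  ∑ j ∈ Finset.range (D.size ν), ∑ l ∈ Finset.range (D.size μ),
    ((-1 : ℂ) ^ l * ((j + l).factorial : ℂ) / ((j.factorial : ℂ) * (l.factorial : ℂ))
        / (D.κ μ - D.κbar ν) ^ (j + l + 1)) •
      (toeplitzH (D.size ν) (-(j : ℤ)) * innerQbar p pbar ν μ l)

/-- The block `K^{(ν,μ)}`. -/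
noncomputable def blockK (p pbar : D.Vecs N) (ν μ : D.Block) :
    Matrix (Fin (D.size ν)) (Fin (D.size μ)) ℂ :=
  ∑ l ∈ Finset.range (D.size ν), ∑ j ∈ Finset.range (D.size μ),
    ((-1 : ℂ) ^ l * ((l + j).factorial : ℂ) / ((l.factorial : ℂ) * (j.factorial : ℂ))
        / (D.κbar ν - D.κ μ) ^ (l + j + 1)) •
      (innerQ p pbar ν μ l * toeplitzH (D.size μ) (j : ℤ))

/-- The matrix `K̄` with the blocks `K̄^{(ν,μ)}`. -/
noncomputable def matKbar (p pbar : D.Vecs N) : Matrix D.Idx D.Idx ℂ :=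
  Matrix.of fun i j => blockKbar p pbar i.1 j.1 i.2 j.2

/-- The matrix `K` with the blocks `K^{(ν,μ)}`. -/
noncomputable def matK (p pbar : D.Vecs N) : Matrix D.Idx D.Idx ℂ :=
  Matrix.of fun i j => blockK p pbar i.1 j.1 i.2 j.2

/-- `p` and `pbar` are `p`-vectors of the soliton matrix `G` with inverse `Ginv`: the matrices
`K̄`, `K` are non-degenerate, and
`G(z) = I - (p) K̄⁻¹ D̄(z) (p̄)`, `Ginv(z) = I - (p) D(z) K⁻¹ (p̄)` away from the poles. -/
structure IsPVectors (G Ginv : ℂ → Matrix (Fin N) (Fin N) ℂ) (p pbar : D.Vecs N) : Prop where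
  isUnit_Kbar : IsUnit (matKbar p pbar).det
  isUnit_K : IsUnit (matK p pbar).det
  eq_soliton : ∀ z, z ∉ Set.range D.kbar →
    G z = 1 - cols p * (matKbar p pbar)⁻¹ * D.poleDbar z * rows pbar
  eq_inverse : ∀ z, z ∉ Set.range D.k →
    Ginv z = 1 - cols p * D.poleD z * (matK p pbar)⁻¹ * rows pbar

/-- The linear system `𝚪_ν(κ_ν) (p_1; …; p_s) = 0`, for all blocks. -/
def KernelEq (G : ℂ → Matrix (Fin N) (Fin N) ℂ) (p : D.Vecs N) : Prop :=
  ∀ ν : D.Block, (lowerToeplitz (D.size ν) G (D.κ ν)).mulVec (stack ν p) = 0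

/-- The linear system `(p̄_1, …, p̄_s) 𝚪̄_ν(κ̄_ν) = 0`, for all blocks. -/
def KernelEqBar (Ginv : ℂ → Matrix (Fin N) (Fin N) ℂ) (pbar : D.Vecs N) : Prop :=
  ∀ ν : D.Block, Matrix.vecMul (stack ν pbar) (upperToeplitz (D.size ν) Ginv (D.κbar ν)) = 0

variable (D) in
/-- Invariance matrices acting on the `p`-vectors: non-degenerate and commuting with `D(z)`. -/
def IsInvariance (B : Matrix D.Idx D.Idx ℂ) : Prop :=
  IsUnit B.det ∧ ∀ z, z ∉ Set.range D.k → B * D.poleD z = D.poleD z * B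

variable (D) in
/-- Invariance matrices acting on the `p̄`-vectors: non-degenerate and commuting with `D̄(z)`. -/
def IsInvarianceBar (B : Matrix D.Idx D.Idx ℂ) : Prop :=
  IsUnit B.det ∧ ∀ z, z ∉ Set.range D.kbar → B * D.poleDbar z = D.poleDbar z * B

/-- `p̃ = p B` and `p̄̃ = B̄ p̄` with invariance matrices `B` and `B̄`. -/
def InvarianceRelated (p pbar p' pbar' : D.Vecs N) : Prop :=
  ∃ B Bbar : Matrix D.Idx D.Idx ℂ, D.IsInvariance B ∧ D.IsInvarianceBar Bbar ∧
    cols p' = cols p * B ∧ rows pbar' = Bbar * rows pbar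

/-- All components are differentiable in `x` and in `t`. -/
def PartialDiff (p : ℝ → ℝ → D.Vecs N) : Prop :=
  ∀ x t i a, DifferentiableAt ℝ (fun y => p y t i a) x ∧
    DifferentiableAt ℝ (fun τ => p x τ i a) t

/-- `∂_x p`. -/
noncomputable def dx (p : ℝ → ℝ → D.Vecs N) (x t : ℝ) : D.Vecs N :=
  fun i a => deriv (fun y => p y t i a) x

/-- `∂_t p`. -/
noncomputable def dt (p : ℝ → ℝ → D.Vecs N) (x t : ℝ) : D.Vecs N :=
  fun i a => deriv (fun τ => p x τ i a) t

/-- `[∂ + 𝐀_ν(κ_ν)] (p_1; …; p_s)`, where `dp` is the derivative `∂ p`. -/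
noncomputable def bracket (A : Matrix (Fin N) (Fin N) ℂ[X]) (dp p : D.Vecs N) (ν : D.Block) :
    Fin (D.size ν) × Fin N → ℂ :=
  stack ν dp + (lowerToeplitz (D.size ν) (evalM A) (D.κ ν)).mulVec (stack ν p)

/-- `∂ (p̄_1, …, p̄_s) - (p̄_1, …, p̄_s) 𝐀̄_ν(κ̄_ν)`, where `dp` is the derivative `∂ p̄`. -/
noncomputable def bracketBar (A : Matrix (Fin N) (Fin N) ℂ[X]) (dp pbar : D.Vecs N)
    (ν : D.Block) : Fin (D.size ν) × Fin N → ℂ :=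
  stack ν dp - Matrix.vecMul (stack ν pbar) (upperToeplitz (D.size ν) (evalM A) (D.κbar ν))

/-- The derived equations
`𝚪_ν(κ_ν) {[∂_x + 𝚲_ν(κ_ν)] p} = 0` and `𝚪_ν(κ_ν) {[∂_t + 𝛀_ν(κ_ν)] p} = 0`. -/
def DerivedEq (lam om : Matrix (Fin N) (Fin N) ℂ[X]) (G : ℝ → ℝ → ℂ → Matrix (Fin N) (Fin N) ℂ)
    (p : ℝ → ℝ → D.Vecs N) : Prop :=
  ∀ x t (ν : D.Block),
    (lowerToeplitz (D.size ν) (G x t) (D.κ ν)).mulVec (bracket lam (dx p x t) (p x t) ν) = 0 ∧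
    (lowerToeplitz (D.size ν) (G x t) (D.κ ν)).mulVec (bracket om (dt p x t) (p x t) ν) = 0

/-- The derived equations
`{∂_x p̄ - p̄ 𝚲̄_ν(κ̄_ν)} 𝚪̄_ν(κ̄_ν) = 0` and `{∂_t p̄ - p̄ 𝛀̄_ν(κ̄_ν)} 𝚪̄_ν(κ̄_ν) = 0`. -/
def DerivedEqBar (lam om : Matrix (Fin N) (Fin N) ℂ[X])
    (Ginv : ℝ → ℝ → ℂ → Matrix (Fin N) (Fin N) ℂ) (pbar : ℝ → ℝ → D.Vecs N) : Prop :=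
  ∀ x t (ν : D.Block),
    Matrix.vecMul (bracketBar lam (dx pbar x t) (pbar x t) ν)
      (upperToeplitz (D.size ν) (Ginv x t) (D.κbar ν)) = 0 ∧
    Matrix.vecMul (bracketBar om (dt pbar x t) (pbar x t) ν)
      (upperToeplitz (D.size ν) (Ginv x t) (D.κbar ν)) = 0

/-- The evolution equations `[∂_x + 𝚲_ν(κ_ν)] p = 0`, `[∂_t + 𝛀_ν(κ_ν)] p = 0`. -/
def EvolutionEq (lam om : Matrix (Fin N) (Fin N) ℂ[X]) (p : ℝ → ℝ → D.Vecs N) : Prop :=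
  ∀ x t (ν : D.Block),
    bracket lam (dx p x t) (p x t) ν = 0 ∧ bracket om (dt p x t) (p x t) ν = 0

/-- The evolution equations `∂_x p̄ = p̄ 𝚲̄_ν(κ̄_ν)`, `∂_t p̄ = p̄ 𝛀̄_ν(κ̄_ν)`. -/
def EvolutionEqBar (lam om : Matrix (Fin N) (Fin N) ℂ[X]) (pbar : ℝ → ℝ → D.Vecs N) : Prop :=
  ∀ x t (ν : D.Block),
    bracketBar lam (dx pbar x t) (pbar x t) ν = 0 ∧ bracketBar om (dt pbar x t) (pbar x t) ν = 0

/-- `exp(-𝚲_ν(κ_ν) x - 𝛀_ν(κ_ν) t)`. -/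
noncomputable def propagator (lam om : Matrix (Fin N) (Fin N) ℂ[X]) (x t : ℝ) (ν : D.Block) :
    Matrix (Fin (D.size ν) × Fin N) (Fin (D.size ν) × Fin N) ℂ :=
  NormedSpace.exp (-((x : ℂ) • lowerToeplitz (D.size ν) (evalM lam) (D.κ ν))
    - (t : ℂ) • lowerToeplitz (D.size ν) (evalM om) (D.κ ν))

/-- `exp(𝚲̄_ν(κ̄_ν) x + 𝛀̄_ν(κ̄_ν) t)`. -/
noncomputable def propagatorBar (lam om : Matrix (Fin N) (Fin N) ℂ[X]) (x t : ℝ) (ν : D.Block) :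
    Matrix (Fin (D.size ν) × Fin N) (Fin (D.size ν) × Fin N) ℂ :=
  NormedSpace.exp ((x : ℂ) • upperToeplitz (D.size ν) (evalM lam) (D.κbar ν)
    + (t : ℂ) • upperToeplitz (D.size ν) (evalM om) (D.κbar ν))

/-- The vectors `exp(-𝚲_ν(κ_ν) x - 𝛀_ν(κ_ν) t) (p_01; …; p_0s)`, for all blocks. -/
noncomputable def evolve (lam om : Matrix (Fin N) (Fin N) ℂ[X]) (p0 : D.Vecs N) (x t : ℝ) :
    D.Vecs N :=
  fun i a => (propagator lam om x t i.1).mulVec (stack i.1 p0) (i.2, a)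

/-- The vectors `(p̄_01, …, p̄_0s) exp(𝚲̄_ν(κ̄_ν) x + 𝛀̄_ν(κ̄_ν) t)`, for all blocks. -/
noncomputable def evolveBar (lam om : Matrix (Fin N) (Fin N) ℂ[X]) (pbar0 : D.Vecs N) (x t : ℝ) :
    D.Vecs N :=
  fun i a => Matrix.vecMul (stack i.1 pbar0) (propagatorBar lam om x t i.1) (i.2, a)

end ZeroData

end Soliton

/-!
Collect the columns `p` into a matrix `P` and let a matrix polynomial `F = ∑ F_k X^k` act by
`F • P = ∑ F_k P A^k`, where `A` is the block Jordan matrix with `𝓓(z) = (z - A)⁻¹`; likewise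
`𝓓̄(z) = (z - Ā)⁻¹`. Blockwise, `F • P` is the action of the block-Toeplitz matrices `𝐅_ν(κ_ν)`.

Since `A` and `Ā` have no common eigenvalue, `K̄` is the unique solution of the Sylvester equation
`K̄ A - Ā K̄ = P̄ P`. It follows that a system with the columns `V` solves `𝚪_ν(κ_ν) v_ν = 0` if
and only if `V = P B` for some `B` commuting with `A`: up to non-degeneracy, the solutions of the
linear system are the invariance transforms of `P`.

Multiplying `Γ` by `det (X - Ā)` turns it into a monic matrix polynomial `F` with
`F' = F Λ + U F`. If `V` solves the derived equations, then `W = F • V` satisfies `W' = U • W`.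
Comparing coefficients at and above the degree of `F` expresses the coefficients of `U` through
those of `F`, so they are continuous in `x`, and the linear equation propagates `W = 0`. The
exponentials solve the derived equations, hence stay in the kernel, and running time backwards
shows that the matrix relating them to `P` is invertible. The statements for the rows are those
for the columns of the data obtained by transposing, swapping the two sets of zeros and replacing
`Λ`, `Ω` by `-Λᵀ`, `-Ωᵀ`.
-/

namespace Soliton

open Matrix
open scoped Topology

section PolyAct

variable {R l m n ι : Type*} [CommRing R] [Fintype n] [Fintype ι] [DecidableEq ι]

/-- The action of matrix polynomials on matrices with `ι` columns in which the variable acts from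
the right as `A`: the polynomial `∑ Fₖ Xᵏ` sends `P` to `∑ Fₖ P Aᵏ`. -/
noncomputable def polyAct (A : Matrix ι ι R) :
    Matrix m n R[X] →ₗ[R] Matrix n ι R →ₗ[R] Matrix m ι R :=
  LinearMap.mk₂ R (fun F P => of fun a i => ∑ b, (P * aeval A (F a b)) b i)
    (fun F G P => by ext; simp [Matrix.mul_add, Finset.sum_add_distrib])
    (fun c F P => by ext; simp [Finset.mul_sum])
    (fun F P Q => by ext; simp [Matrix.add_mul, Finset.sum_add_distrib])
    (fun c F P => by ext; simp [Finset.mul_sum])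

variable (A : Matrix ι ι R)

theorem polyAct_apply (F : Matrix m n R[X]) (P : Matrix n ι R) (a : m) (i : ι) :
    polyAct A F P a i = ∑ b, (P * aeval A (F a b)) b i := rfl

theorem polyAct_mul [Fintype m] (F : Matrix l m R[X]) (G : Matrix m n R[X]) (P : Matrix n ι R) :
    polyAct A (F * G) P = polyAct A F (polyAct A G P) := by
  ext a i
  have hright (c : m) : (polyAct A G P * aeval A (F a c)) c i =
      ∑ b, (P * aeval A (F a c * G c b)) b i := by
    simp_rw [mul_apply, polyAct_apply, Finset.sum_mul]
    rw [Finset.sum_comm]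
    simp_rw [← mul_apply, mul_comm (F a c), map_mul, ← Matrix.mul_assoc]
  rw [polyAct_apply, polyAct_apply]
  simp_rw [hright, Matrix.mul_apply (M := F), map_sum, Matrix.mul_sum, Matrix.sum_apply]
  exact Finset.sum_comm

theorem polyAct_map_C (S : Matrix m n R) (P : Matrix n ι R) : polyAct A (S.map C) P = S * P := by
  ext a i
  simp [polyAct_apply, mul_apply, Matrix.algebraMap_matrix_apply, mul_comm]

theorem polyAct_smul_one [DecidableEq n] (q : R[X]) (P : Matrix n ι R) :
    polyAct A (q • (1 : Matrix n n R[X])) P = P * aeval A q := by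
  ext a i
  rw [polyAct_apply, Finset.sum_eq_single a]
  · simp
  · intro b _ hb
    simp [one_apply_ne hb.symm]
  · simp

theorem semiconjBy_aeval {S : Type*} [Ring S] [Algebra R S] {y a b : S} (h : SemiconjBy y a b)
    (q : R[X]) : SemiconjBy y (aeval a q) (aeval b q) := by
  induction q using Polynomial.induction_on' with
  | add p q hp hq => simpa using hp.add_right hq
  | monomial n c =>
    simpa [aeval_monomial] using
      SemiconjBy.mul_right (Algebra.commutes c y).symm (h.pow_right n)

theorem polyAct_mul_right {A B : Matrix ι ι R} (h : Commute A B) (F : Matrix m n R[X])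
    (P : Matrix n ι R) : polyAct A F (P * B) = polyAct A F P * B := by
  ext a i
  have hB (b : n) : (P * B * aeval A (F a b)) b i = (P * aeval A (F a b) * B) b i := by
    rw [Matrix.mul_assoc, (semiconjBy_aeval h.symm (F a b)).eq, Matrix.mul_assoc]
  simp_rw [polyAct_apply, hB, mul_apply (N := B), polyAct_apply, Finset.sum_mul]
  exact Finset.sum_comm

theorem polyAct_charmatrix (A' Y : Matrix ι ι R) :
    polyAct A (charmatrix A') Y = Y * A - A' * Y := by
  have hchar : charmatrix A' = (X : R[X]) • (1 : Matrix ι ι R[X]) - A'.map C := by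
    rw [charmatrix, scalar_apply, smul_one_eq_diagonal]; rfl
  rw [hchar, map_sub, LinearMap.sub_apply, polyAct_smul_one, polyAct_map_C, aeval_X]

end PolyAct

section Dressing

variable {R n ι : Type*} [CommRing R] [Fintype n] [Fintype ι] [DecidableEq ι]
  {A A' M : Matrix ι ι R} {P : Matrix n ι R} {P' : Matrix ι n R}

theorem isUnit_aeval_charpoly (h : IsCoprime A.charpoly A'.charpoly) :
    IsUnit (aeval A A'.charpoly) := by
  obtain ⟨a, b, hab⟩ := h
  have hab' := congrArg (aeval A) hab
  rw [map_add, map_mul, map_mul, aeval_self_charpoly, mul_zero, zero_add, map_one] at hab'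
  exact .of_mul_eq_one_right _ hab'

theorem eq_zero_of_semiconjBy_of_isCoprime_charpoly (hc : IsCoprime A.charpoly A'.charpoly)
    {Y : Matrix ι ι R} (h : SemiconjBy Y A A') : Y = 0 := by
  have hY := (semiconjBy_aeval h A'.charpoly).eq
  rw [aeval_self_charpoly, zero_mul] at hY
  exact (isUnit_aeval_charpoly hc).mul_left_eq_zero.1 hY

/-- The numerator of the dressing matrix: `det (X - A')` times `1 - P M⁻¹ (X - A')⁻¹ P'`. -/
noncomputable def dressingNumerator [DecidableEq n] (A' M : Matrix ι ι R) (P : Matrix n ι R)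
    (P' : Matrix ι n R) : Matrix n n R[X] :=
  A'.charpoly • 1 - (P * M⁻¹).map C * (adjugate (charmatrix A') * P'.map C)

theorem polyAct_dressingNumerator [DecidableEq n] (A A' M : Matrix ι ι R) (P : Matrix n ι R)
    (P' : Matrix ι n R) (Q : Matrix n ι R) :
    polyAct A (dressingNumerator A' M P P') Q =
      Q * aeval A A'.charpoly - P * M⁻¹ * polyAct A (adjugate (charmatrix A')) (P' * Q) := by
  rw [dressingNumerator, map_sub, LinearMap.sub_apply, polyAct_smul_one, polyAct_mul, polyAct_mul,
    polyAct_map_C, polyAct_map_C]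

theorem polyAct_dressingNumerator_mul_eq_zero [DecidableEq n] (hM : IsUnit M.det)
    (hS : M * A - A' * M = P' * P) {B : Matrix ι ι R} (hB : Commute A B) :
    polyAct A (dressingNumerator A' M P P') (P * B) = 0 := by
  rw [polyAct_mul_right hB, polyAct_dressingNumerator, ← hS, ← polyAct_charmatrix, ← polyAct_mul,
    adjugate_mul, ← charpoly, polyAct_smul_one, ← Matrix.mul_assoc,
    nonsing_inv_mul_cancel_right _ _ hM, sub_self, Matrix.zero_mul]

theorem exists_commute_of_polyAct_dressingNumerator_eq_zero [DecidableEq n]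
    (hc : IsCoprime A.charpoly A'.charpoly) (hM : IsUnit M.det) (hS : M * A - A' * M = P' * P)
    {Q : Matrix n ι R} (hQ : polyAct A (dressingNumerator A' M P P') Q = 0) :
    ∃ B, Commute A B ∧ Q = P * B := by
  set Y := M⁻¹ * polyAct A (adjugate (charmatrix A')) (P' * Q) with hY
  have hMY : M * Y = polyAct A (adjugate (charmatrix A')) (P' * Q) :=
    mul_nonsing_inv_cancel_left _ _ hM
  have hQY : Q * aeval A A'.charpoly = P * Y := by
    rwa [polyAct_dressingNumerator, sub_eq_zero, Matrix.mul_assoc] at hQ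
  have hsylvester : M * Y * A - A' * (M * Y) = P' * P * Y := by
    rw [← polyAct_charmatrix, hMY, ← polyAct_mul, mul_adjugate, ← charpoly, polyAct_smul_one,
      Matrix.mul_assoc, hQY, Matrix.mul_assoc]
  have hAY : Commute A Y := by
    rw [← hS, sub_mul, ← mul_assoc A', sub_left_inj, mul_assoc M Y, mul_assoc M A] at hsylvester
    exact (((isUnit_iff_isUnit_det M).2 hM).mul_left_cancel hsylvester).symm
  obtain ⟨u, hu⟩ := isUnit_aeval_charpoly hc
  have hAu : Commute A u := hu ▸ semiconjBy_aeval (Commute.refl A) A'.charpoly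
  refine ⟨Y * (↑u⁻¹ : Matrix ι ι R), hAY.mul_right hAu.units_inv_right, ?_⟩
  rw [← Matrix.mul_assoc, ← hQY, ← hu, Matrix.mul_assoc, Units.mul_inv, Matrix.mul_one]

theorem eq_zero_of_mul_eq_zero_of_commute (hc : IsCoprime A.charpoly A'.charpoly)
    (hM : IsUnit M.det) (hS : M * A - A' * M = P' * P) {B : Matrix ι ι R} (hB : Commute A B)
    (h : P * B = 0) : B = 0 := by
  have hMB : SemiconjBy (M * B) A A' := by
    have hSB : (M * A - A' * M) * B = 0 := by rw [hS, Matrix.mul_assoc, h, Matrix.mul_zero]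
    rw [sub_mul, sub_eq_zero, mul_assoc, hB.eq] at hSB
    simpa only [SemiconjBy, mul_assoc] using hSB
  rw [← nonsing_inv_mul_cancel_left _ B hM,
    eq_zero_of_semiconjBy_of_isCoprime_charpoly hc hMB, Matrix.mul_zero]

end Dressing

section LinearODE

theorem eq_zero_of_hasDerivAt_clm {E : Type*} [NormedAddCommGroup E] [NormedSpace ℝ E]
    {T : ℝ → E →L[ℝ] E} (hT : Continuous T) {y : ℝ → E} (hy : ∀ x, HasDerivAt y (T x (y x)) x)
    {x₀ : ℝ} (h₀ : y x₀ = 0) (x : ℝ) : y x = 0 := by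
  obtain ⟨a, b, hx, hx₀⟩ : ∃ a b, x ∈ Set.Ioo a b ∧ x₀ ∈ Set.Ioo a b :=
    ⟨min x x₀ - 1, max x x₀ + 1, by grind, by grind⟩
  obtain ⟨K, hK⟩ := (isCompact_Icc (a := a) (b := b)).bddAbove_image hT.nnnorm.continuousOn
  refine ODE_solution_unique_of_mem_Ioo (v := fun s => T s) (s := fun _ => Set.univ) (K := K)
    (g := fun _ => 0) (fun s hs => ?_) hx₀ (fun s _ => ⟨hy s, trivial⟩)
    (fun s _ => ⟨by simpa using hasDerivAt_const s (0 : E), trivial⟩) h₀ hx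
  exact ((T s).lipschitz.weaken (hK ⟨s, Set.Ioo_subset_Icc_self hs, rfl⟩)).lipschitzOnWith

theorem hasDerivAt_matrix {m n 𝕜 E : Type*} [Finite n] [NontriviallyNormedField 𝕜]
    [NormedAddCommGroup E] [NormedSpace 𝕜 E] {f : 𝕜 → Matrix m n E} {f' : Matrix m n E} {x : 𝕜} :
    HasDerivAt f f' x ↔ ∀ a b, HasDerivAt (fun y => f y a b) (f' a b) x := by
  cases nonempty_fintype n
  exact hasDerivAt_pi.trans (forall_congr' fun _ => hasDerivAt_pi)

theorem hasDerivAt_matrix_mul {m n ι 𝕜 𝔸 : Type*} [Fintype n] [Finite ι]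
    [NontriviallyNormedField 𝕜] [NormedRing 𝔸] [NormedAlgebra 𝕜 𝔸] {f : 𝕜 → Matrix m n 𝔸}
    {g : 𝕜 → Matrix n ι 𝔸} {f' : Matrix m n 𝔸} {g' : Matrix n ι 𝔸} {x : 𝕜}
    (hf : HasDerivAt f f' x) (hg : HasDerivAt g g' x) :
    HasDerivAt (fun y => f y * g y) (f' * g x + f x * g') x := by
  refine hasDerivAt_matrix.2 fun a b => ?_
  simp_rw [Matrix.add_apply, Matrix.mul_apply, ← Finset.sum_add_distrib]
  exact .fun_sum fun c _ => (hasDerivAt_matrix.1 hf a c).mul (hasDerivAt_matrix.1 hg c b)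

theorem matrix_eq_zero_of_hasDerivAt {m n E : Type*} [Finite m] [Finite n]
    [NormedAddCommGroup E] [NormedSpace ℝ E] [FiniteDimensional ℝ E]
    {T : ℝ → Matrix m n E →ₗ[ℝ] Matrix m n E} (hT : ∀ Y, Continuous fun x => T x Y)
    {y : ℝ → Matrix m n E} (hy : ∀ x, HasDerivAt y (T x (y x)) x) {x₀ : ℝ} (h₀ : y x₀ = 0)
    (x : ℝ) : y x = 0 := by
  cases nonempty_fintype m
  cases nonempty_fintype n
  open scoped Matrix.Norms.Elementwise in
  exact eq_zero_of_hasDerivAt_clm (T := fun x => LinearMap.toContinuousLinearMap (T x))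
    (continuous_clm_apply.2 hT) hy h₀ x

end LinearODE

section PolynomialFamilies

theorem hasDerivAt_linearMap_of_eval {𝕜 K : Type*} [NontriviallyNormedField 𝕜] [NormedField K]
    [NormedAlgebra 𝕜 K] {f : 𝕜 → K[X]} {g : K[X]} {x : 𝕜} {d : ℕ}
    (hd : ∀ y, (f y).natDegree ≤ d) {S : Set K} (hS : S.Infinite)
    (h : ∀ z ∈ S, HasDerivAt (fun y => (f y).eval z) (g.eval z) x) (φ : K[X] →ₗ[K] K) :
    HasDerivAt (fun y => φ (f y)) (φ g) x := by
  classical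
  obtain ⟨t, htS, hcard⟩ := hS.exists_subset_card_eq (max d g.natDegree + 1)
  have hinterpolate (p : K[X]) (hp : p.natDegree ≤ max d g.natDegree) :
      φ p = ∑ z ∈ t, p.eval z * φ (Lagrange.basis t id z) := by
    have hdeg : p.degree < t.card :=
      degree_le_natDegree.trans_lt (by exact_mod_cast (by omega : p.natDegree < t.card))
    conv_lhs => rw [Lagrange.eq_interpolate (Set.injOn_id _) hdeg, Lagrange.interpolate_apply]
    simp [← smul_eq_C_mul]
  rw [hinterpolate g (le_max_right _ _),
    funext fun y => hinterpolate (f y) ((hd y).trans (le_max_left _ _))]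
  exact .fun_sum fun z hz => (h z (htS hz)).mul_const _

theorem continuous_linearMap_of_coeff {α R : Type*} [TopologicalSpace α] [CommSemiring R]
    [TopologicalSpace R] [IsTopologicalSemiring R] {f : α → R[X]} {d : ℕ}
    (hd : ∀ y, (f y).natDegree ≤ d) (h : ∀ k, Continuous fun y => (f y).coeff k)
    (φ : R[X] →ₗ[R] R) : Continuous fun y => φ (f y) := by
  have hsum (y : α) : φ (f y) = ∑ k ∈ Finset.range (d + 1), (f y).coeff k * φ (X ^ k) := by
    conv_lhs => rw [as_sum_range_C_mul_X_pow' (f y) (Nat.lt_succ_of_le (hd y))]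
    simp [← smul_eq_C_mul]
  simp_rw [hsum]
  exact continuous_finsetSum _ fun k _ => (h k).mul continuous_const

theorem coeff_mul_add_of_natDegree_le {S : Type*} [Semiring S] (p : S[X]) {q : S[X]} {d : ℕ}
    (hq : q.natDegree ≤ d) (k : ℕ) : (p * q).coeff (k + d) =
      ∑ j ∈ Finset.range d, p.coeff (k + d - j) * q.coeff j + p.coeff k * q.coeff d := by
  rw [coeff_mul, ← Finset.Nat.sum_antidiagonal_swap,
    Finset.Nat.sum_antidiagonal_eq_sum_range_succ_mk]
  rw [← Finset.sum_subset (Finset.range_subset_range.2 (by omega : d + 1 ≤ (k + d).succ)),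
    Finset.sum_range_succ]
  · simp
  · intro j _ hj
    rw [Prod.fst_swap, Prod.snd_swap,
      coeff_eq_zero_of_natDegree_lt (hq.trans_lt (by simpa using hj)), mul_zero]

theorem natDegree_le_of_coeff_mul_eq_zero {S : Type*} [Semiring S] {p q : S[X]} {d L : ℕ}
    (hq : q.natDegree ≤ d) (hqd : q.coeff d = 1) (h : ∀ k > L, (p * q).coeff (k + d) = 0) :
    p.natDegree ≤ L := by
  by_contra! hL
  have hlead := h _ hL
  rw [coeff_mul_add_eq_of_natDegree_le le_rfl hq, hqd, mul_one, coeff_natDegree,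
    leadingCoeff_eq_zero] at hlead
  simp [hlead] at hL

theorem continuous_coeff_of_mul {α S : Type*} [TopologicalSpace α] [Ring S] [TopologicalSpace S]
    [IsTopologicalRing S] {p q : α → S[X]} {d L : ℕ} (hp : ∀ x, (p x).natDegree ≤ L)
    (hq : ∀ x, (q x).natDegree ≤ d) (hqd : ∀ x, (q x).coeff d = 1)
    (hqc : ∀ k, Continuous fun x => (q x).coeff k)
    (hpq : ∀ k, Continuous fun x => (p x * q x).coeff (k + d)) (k : ℕ) :
    Continuous fun x => (p x).coeff k := by
  induction hm : L + 1 - k using Nat.strong_induction_on generalizing k with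
  | _ m ih =>
    rcases lt_or_ge L k with hk | hk
    · simpa only [coeff_eq_zero_of_natDegree_lt ((hp _).trans_lt hk)] using continuous_const
    · have hrec (x : α) : (p x).coeff k = (p x * q x).coeff (k + d) -
          ∑ j ∈ Finset.range d, (p x).coeff (k + d - j) * (q x).coeff j := by
        rw [coeff_mul_add_of_natDegree_le _ (hq x), hqd, mul_one, add_sub_cancel_left]
      simp_rw [hrec]
      refine (hpq k).sub (continuous_finsetSum _ fun j hj => ?_)
      have hj := Finset.mem_range.1 hj
      exact (ih _ (by omega) (k + d - j) rfl).mul (hqc j)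

end PolynomialFamilies

section LaxFamily

variable {n ι : Type*} [Fintype n] [DecidableEq n] [Fintype ι] [DecidableEq ι]

/-- A family of matrix polynomials `F x` of degree `d` with leading coefficient `1` that solves the
Lax equation `F' = F lam + U F` with polynomial potentials `U x`. The derivative is tested by
linear functionals, `ℂ[X]` having no topology. -/
structure IsLaxFamily (d : ℕ) (lam : Matrix n n ℂ[X]) (F U : ℝ → Matrix n n ℂ[X]) : Prop where
  natDegree_le : ∀ x a b, (F x a b).natDegree ≤ d
  coeff_eq_one : ∀ x, (F x).map (fun p => p.coeff d) = 1
  hasDerivAt : ∀ x a b (φ : ℂ[X] →ₗ[ℂ] ℂ),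
    HasDerivAt (fun y => φ (F y a b)) (φ ((F x * lam + U x * F x) a b)) x

theorem natDegree_matPolyEquiv_le {R : Type*} [CommRing R] {F : Matrix n n R[X]} {d : ℕ}
    (h : ∀ a b, (F a b).natDegree ≤ d) : (matPolyEquiv F).natDegree ≤ d := by
  refine natDegree_le_iff_coeff_eq_zero.2 fun k hk => ?_
  ext a b
  rw [matPolyEquiv_coeff_apply, coeff_eq_zero_of_natDegree_lt ((h a b).trans_lt hk),
    Matrix.zero_apply]

namespace IsLaxFamily

variable {d : ℕ} {lam : Matrix n n ℂ[X]} {F U : ℝ → Matrix n n ℂ[X]}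

theorem natDegree_matPolyEquiv_le (h : IsLaxFamily d lam F U) (x : ℝ) :
    (matPolyEquiv (F x)).natDegree ≤ d :=
  Soliton.natDegree_matPolyEquiv_le (h.natDegree_le x)

theorem coeff_matPolyEquiv (h : IsLaxFamily d lam F U) (x : ℝ) :
    (matPolyEquiv (F x)).coeff d = 1 := by
  rw [← h.coeff_eq_one x]
  ext a b
  exact matPolyEquiv_coeff_apply _ _ _ _

theorem continuous_coeff_matPolyEquiv (h : IsLaxFamily d lam F U) (k : ℕ) :
    Continuous fun x => (matPolyEquiv (F x)).coeff k := by
  refine continuous_matrix fun a b => continuous_iff_continuousAt.2 fun x => ?_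
  simp_rw [matPolyEquiv_coeff_apply]
  exact (h.hasDerivAt x a b (lcoeff ℂ k)).continuousAt

theorem coeff_potential_mul (h : IsLaxFamily d lam F U) (x : ℝ) {k : ℕ} (hk : d ≤ k) :
    (matPolyEquiv (U x) * matPolyEquiv (F x)).coeff k =
      -(matPolyEquiv (F x) * matPolyEquiv lam).coeff k := by
  ext a b
  have hconst (y : ℝ) : (F y a b).coeff k = if k = d then (1 : Matrix n n ℂ) a b else 0 := by
    split_ifs with hkd
    · rw [hkd, ← h.coeff_eq_one y]; rfl
    · exact coeff_eq_zero_of_natDegree_lt ((h.natDegree_le y a b).trans_lt (by omega))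
  have hderiv := (h.hasDerivAt x a b (lcoeff ℂ k)).unique
    (by simpa only [lcoeff_apply, hconst] using hasDerivAt_const x _)
  rw [lcoeff_apply, Matrix.add_apply, coeff_add] at hderiv
  rw [← map_mul, ← map_mul, Matrix.neg_apply, matPolyEquiv_coeff_apply, matPolyEquiv_coeff_apply]
  exact eq_neg_of_add_eq_zero_right hderiv

theorem natDegree_potential_le (h : IsLaxFamily d lam F U) (x : ℝ) :
    (matPolyEquiv (U x)).natDegree ≤ (matPolyEquiv lam).natDegree := by
  refine natDegree_le_of_coeff_mul_eq_zero (h.natDegree_matPolyEquiv_le x)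
    (h.coeff_matPolyEquiv x) fun k hk => ?_
  rw [h.coeff_potential_mul x (Nat.le_add_left d k), neg_eq_zero]
  refine coeff_eq_zero_of_natDegree_lt (natDegree_mul_le.trans_lt ?_)
  have := h.natDegree_matPolyEquiv_le x
  omega

theorem continuous_coeff_potential (h : IsLaxFamily d lam F U) (k : ℕ) :
    Continuous fun x => (matPolyEquiv (U x)).coeff k := by
  refine continuous_coeff_of_mul h.natDegree_potential_le h.natDegree_matPolyEquiv_le
    h.coeff_matPolyEquiv h.continuous_coeff_matPolyEquiv (fun k => ?_) k
  simp_rw [h.coeff_potential_mul _ (Nat.le_add_left d k), coeff_mul]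
  exact (continuous_finsetSum _ fun q _ =>
    (h.continuous_coeff_matPolyEquiv q.1).mul continuous_const).neg

variable (A : Matrix ι ι ℂ)

theorem continuous_polyAct_potential (h : IsLaxFamily d lam F U) (Y : Matrix n ι ℂ) :
    Continuous fun x => polyAct A (U x) Y := by
  have hcoeff (a b : n) (k : ℕ) : Continuous fun x => (U x a b).coeff k := by
    simpa only [matPolyEquiv_coeff_apply] using (h.continuous_coeff_potential k).matrix_elem a b
  have hdeg (x : ℝ) (a b : n) : (U x a b).natDegree ≤ (matPolyEquiv lam).natDegree := by
    refine natDegree_le_iff_coeff_eq_zero.2 fun k hk => ?_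
    rw [← matPolyEquiv_coeff_apply,
      coeff_eq_zero_of_natDegree_lt ((h.natDegree_potential_le x).trans_lt hk), Matrix.zero_apply]
  have haeval (a b : n) : Continuous fun x => aeval A (U x a b) :=
    continuous_matrix fun i j => continuous_linearMap_of_coeff (hdeg · a b) (hcoeff a b)
      (entryLinearMap ℂ ℂ i j ∘ₗ (aeval A).toLinearMap)
  refine continuous_matrix fun a i => ?_
  simp_rw [polyAct_apply]
  exact continuous_finsetSum _ fun b _ => (continuous_const.matrix_mul (haeval a b)).matrix_elem b i

theorem hasDerivAt_aeval (h : IsLaxFamily d lam F U) (x : ℝ) (a b : n) :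
    HasDerivAt (fun y => aeval A (F y a b)) (aeval A ((F x * lam + U x * F x) a b)) x := by
  refine hasDerivAt_matrix.2 fun i j => ?_
  exact h.hasDerivAt x a b (entryLinearMap ℂ ℂ i j ∘ₗ (aeval A).toLinearMap)

theorem hasDerivAt_polyAct (h : IsLaxFamily d lam F U) {P : ℝ → Matrix n ι ℂ}
    {P' : Matrix n ι ℂ} {x : ℝ} (hP : HasDerivAt P P' x) :
    HasDerivAt (fun y => polyAct A (F y) (P y))
      (polyAct A (F x) (P' + polyAct A lam (P x)) + polyAct A (U x) (polyAct A (F x) (P x)))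
      x := by
  have hproduct : HasDerivAt (fun y => polyAct A (F y) (P y))
      (polyAct A (F x) P' + polyAct A (F x * lam + U x * F x) (P x)) x := by
    refine hasDerivAt_matrix.2 fun a i => ?_
    simp only [polyAct_apply, Matrix.add_apply, ← Finset.sum_add_distrib]
    refine .fun_sum fun b _ => ?_
    have hmul := hasDerivAt_matrix_mul hP (h.hasDerivAt_aeval A x a b)
    have hentry := hasDerivAt_matrix.1 hmul b i
    rwa [Matrix.add_apply, Matrix.add_apply] at hentry
  convert hproduct using 1
  rw [map_add (polyAct A (F x)), add_assoc, ← polyAct_mul, ← polyAct_mul, map_add (polyAct A),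
    LinearMap.add_apply]

theorem polyAct_eq_zero (h : IsLaxFamily d lam F U) {P P' : ℝ → Matrix n ι ℂ}
    (hP : ∀ x, HasDerivAt P (P' x) x)
    (hder : ∀ x, polyAct A (F x) (P' x + polyAct A lam (P x)) = 0) {x₀ : ℝ}
    (h₀ : polyAct A (F x₀) (P x₀) = 0) (x : ℝ) : polyAct A (F x) (P x) = 0 := by
  refine matrix_eq_zero_of_hasDerivAt (y := fun x => polyAct A (F x) (P x))
    (T := fun x => (polyAct A (U x)).restrictScalars ℝ) (h.continuous_polyAct_potential A)
    (fun x => ?_) h₀ x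
  have hderiv := h.hasDerivAt_polyAct A (hP x)
  rw [hder, zero_add] at hderiv
  exact hderiv

theorem polyAct_derivative_eq_zero (h : IsLaxFamily d lam F U) {P : ℝ → Matrix n ι ℂ}
    {P' : Matrix n ι ℂ} {x : ℝ} (hP : HasDerivAt P P' x)
    (hzero : ∀ y, polyAct A (F y) (P y) = 0) :
    polyAct A (F x) (P' + polyAct A lam (P x)) = 0 := by
  have hderiv := h.hasDerivAt_polyAct A hP
  simp_rw [hzero, map_zero, add_zero] at hderiv
  ext a i
  exact (hasDerivAt_matrix.1 hderiv a i).unique (hasDerivAt_const x _)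

end IsLaxFamily

end LaxFamily

section Toeplitz

section ToeplitzHom

variable {R : Type*} [CommRing R]

theorem sum_ite_mul_ite_eq_sum_antidiagonal {s : ℕ} (u v : ℕ → R) (α β : Fin s) :
    ∑ γ, (if α ≤ γ then u (γ - α) else 0) * (if γ ≤ β then v (β - γ) else 0) =
      if α ≤ β then ∑ p ∈ Finset.HasAntidiagonal.antidiagonal (β.val - α.val), u p.1 * v p.2
      else 0 := by
  simp_rw [ite_zero_mul_ite_zero, ← Finset.mem_Icc, Finset.sum_ite_mem, Finset.univ_inter]
  split_ifs with hαβ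
  · refine Finset.sum_nbij (fun γ => (γ.val - α.val, β.val - γ.val)) ?_ ?_ ?_ fun _ _ => rfl
    · intro γ hγ
      rw [Finset.mem_Icc, Fin.le_def, Fin.le_def] at hγ
      rw [Finset.HasAntidiagonal.mem_antidiagonal]
      omega
    · intro γ hγ γ' hγ' h
      simp only [Finset.coe_Icc, Set.mem_Icc, Prod.mk.injEq] at hγ hγ' h
      omega
    · intro p hp
      rw [Finset.mem_coe, Finset.HasAntidiagonal.mem_antidiagonal] at hp
      refine ⟨⟨α + p.1, by omega⟩, ?_, ?_⟩
      · simp only [Finset.coe_Icc, Set.mem_Icc, Fin.le_def]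
        omega
      · ext <;> simp only <;> omega
  · rw [Finset.Icc_eq_empty hαβ, Finset.sum_empty]

/-- The upper-triangular Toeplitz matrix with the coefficients of a power series on its diagonals;
this is the value of the power series at the nilpotent Jordan block. -/
noncomputable def toeplitzHom (R : Type*) [CommRing R] (s : ℕ) :
    PowerSeries R →ₐ[R] Matrix (Fin s) (Fin s) R :=
  AlgHom.ofLinearMap
    { toFun := fun f => of fun α β => if α ≤ β then f.coeff (β - α) else 0
      map_add' := fun f g => by ext α β; simp [ite_add_zero]
      map_smul' := fun c f => by ext α β; simp }
    (by
      ext α β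
      simp only [LinearMap.coe_mk, AddHom.coe_mk, of_apply, PowerSeries.coeff_one, one_apply]
      grind)
    (fun f g => by
      ext α β
      simp only [LinearMap.coe_mk, AddHom.coe_mk, of_apply, mul_apply, PowerSeries.coeff_mul]
      exact (sum_ite_mul_ite_eq_sum_antidiagonal (f.coeff ·) (g.coeff ·) α β).symm)

theorem toeplitzHom_apply (s : ℕ) (f : PowerSeries R) (α β : Fin s) :
    toeplitzHom R s f α β = if α ≤ β then f.coeff (β - α) else 0 := rfl

theorem toeplitzHom_X_pow (s k : ℕ) : toeplitzHom ℂ s (PowerSeries.X ^ k) = toeplitzH s k := by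
  ext α β
  simp only [toeplitzHom_apply, PowerSeries.coeff_X_pow, toeplitzH, of_apply]
  grind

theorem toeplitzH_one_pow (s k : ℕ) : toeplitzH s 1 ^ k = toeplitzH s k := by
  rw [← Nat.cast_one, ← toeplitzHom_X_pow, ← toeplitzHom_X_pow, pow_one, map_pow]

end ToeplitzHom

/-- The Jordan block of size `s` with eigenvalue `z`. -/
noncomputable def jordanBlock (s : ℕ) (z : ℂ) : Matrix (Fin s) (Fin s) ℂ :=
  z • 1 + toeplitzH s 1

theorem jordanBlock_eq_toeplitzHom (s : ℕ) (z : ℂ) :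
    jordanBlock s z = toeplitzHom ℂ s (PowerSeries.C z + PowerSeries.X) := by
  rw [map_add, ← pow_one PowerSeries.X, toeplitzHom_X_pow, Nat.cast_one,
    ← PowerSeries.algebraMap_eq, AlgHom.commutes, Algebra.algebraMap_eq_smul_one]
  rfl

theorem aeval_jordanBlock (s : ℕ) (z : ℂ) (f : ℂ[X]) :
    aeval (jordanBlock s z) f = toeplitzHom ℂ s (taylor z f : ℂ[X]) := by
  have hcoe := aeval_algHom_apply (coeToPowerSeries.algHom ℂ) (X + C z) f
  simp only [coeToPowerSeries.algHom_apply, coe_add, coe_X, coe_C, Algebra.algebraMap_self,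
    PowerSeries.map_id, id_eq] at hcoe
  rw [jordanBlock_eq_toeplitzHom, aeval_algHom_apply, taylor_apply, add_comm, hcoe, comp_eq_aeval]

/-- The Taylor series of a function at `z`. -/
noncomputable def taylorSeries (f : ℂ → ℂ) (z : ℂ) : PowerSeries ℂ :=
  PowerSeries.mk fun n => iteratedDeriv n f z / n.factorial

theorem taylorSeries_mul {f g : ℂ → ℂ} {z : ℂ} (hf : AnalyticAt ℂ f z) (hg : AnalyticAt ℂ g z) :
    taylorSeries (f * g) z = taylorSeries f z * taylorSeries g z := by
  ext n
  rw [PowerSeries.coeff_mul, Finset.Nat.sum_antidiagonal_eq_sum_range_succ_mk]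
  simp only [taylorSeries, PowerSeries.coeff_mk]
  rw [iteratedDeriv_mul hf.contDiffAt hg.contDiffAt, Finset.sum_div]
  refine Finset.sum_congr rfl fun k hk => ?_
  rw [Nat.cast_choose ℂ (Finset.mem_range_succ_iff.1 hk)]
  field_simp [Nat.factorial_ne_zero]

theorem taylorSeries_sum {ι : Type*} {t : Finset ι} {f : ι → ℂ → ℂ} {z : ℂ}
    (hf : ∀ i ∈ t, AnalyticAt ℂ (f i) z) :
    taylorSeries (∑ i ∈ t, f i) z = ∑ i ∈ t, taylorSeries (f i) z := by
  ext n
  simp only [taylorSeries, map_sum, PowerSeries.coeff_mk]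
  rw [iteratedDeriv_sum fun i hi => (hf i hi).contDiffAt, Finset.sum_div]

theorem taylorSeries_eval (f : ℂ[X]) (z : ℂ) :
    taylorSeries (fun w => f.eval w) z = (taylor z f : ℂ[X]) := by
  have hderiv : Function.Semiconj (fun (p : ℂ[X]) (w : ℂ) => p.eval w) derivative deriv :=
    fun p => funext fun _ => p.deriv.symm
  ext n
  rw [taylorSeries, PowerSeries.coeff_mk, iteratedDeriv_eq_iterate, ← (hderiv.iterate_right n) f,
    coeff_coe, taylor_coeff, ← factorial_smul_hasseDeriv]
  simp [Nat.factorial_ne_zero]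

variable {N : ℕ} {s : ℕ}

theorem lowerToeplitz_apply (F : ℂ → Matrix (Fin N) (Fin N) ℂ) (z : ℂ) (i j : Fin s × Fin N) :
    lowerToeplitz s F z i j = toeplitzHom ℂ s (taylorSeries (fun w => F w i.2 j.2) z) j.1 i.1 := by
  simp only [lowerToeplitz, of_apply, toeplitzHom_apply, taylorSeries, PowerSeries.coeff_mk]

theorem lowerToeplitz_congr {F G : ℂ → Matrix (Fin N) (Fin N) ℂ} {z : ℂ} (h : F =ᶠ[𝓝 z] G) :
    lowerToeplitz s F z = lowerToeplitz s G z := by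
  ext i j
  have hentry : (fun w => F w i.2 j.2) =ᶠ[𝓝 z] fun w => G w i.2 j.2 :=
    h.fun_comp fun M => M i.2 j.2
  simp only [lowerToeplitz, of_apply, hentry.iteratedDeriv_eq]

theorem lowerToeplitz_mul {F G : ℂ → Matrix (Fin N) (Fin N) ℂ} {z : ℂ}
    (hF : ∀ a b, AnalyticAt ℂ (fun w => F w a b) z)
    (hG : ∀ a b, AnalyticAt ℂ (fun w => G w a b) z) :
    lowerToeplitz s (fun w => F w * G w) z = lowerToeplitz s F z * lowerToeplitz s G z := by
  ext ⟨i, a⟩ ⟨j, b⟩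
  have hentry : (fun w => (F w * G w) a b) =
      ∑ c, (fun w => F w a c) * (fun w => G w c b) := by
    ext w
    simp [mul_apply]
  rw [lowerToeplitz_apply, hentry, taylorSeries_sum fun c _ => (hF a c).mul (hG c b)]
  simp_rw [taylorSeries_mul (hF a _) (hG _ b), map_sum, Matrix.sum_apply, mul_apply,
    Fintype.sum_prod_type, lowerToeplitz_apply]
  rw [Finset.sum_comm]
  refine Finset.sum_congr rfl fun c _ => ?_
  rw [mul_comm, map_mul, mul_apply]
  exact Finset.sum_congr rfl fun _ _ => mul_comm _ _

theorem lowerToeplitz_evalM (F : Matrix (Fin N) (Fin N) ℂ[X]) (z : ℂ) (i j : Fin s × Fin N) :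
    lowerToeplitz s (evalM F) z i j = aeval (jordanBlock s z) (F i.2 j.2) j.1 i.1 := by
  rw [aeval_jordanBlock, ← taylorSeries_eval, lowerToeplitz_apply]
  rfl

end Toeplitz

section Sylvester

theorem toeplitzH_transpose (s : ℕ) (j : ℤ) : (toeplitzH s j)ᵀ = toeplitzH s (-j) := by
  ext α β
  simp only [toeplitzH, transpose_apply, of_apply]
  grind

theorem toeplitzH_one_pow_self (s : ℕ) : toeplitzH s 1 ^ s = 0 := by
  rw [toeplitzH_one_pow]
  ext α β
  simp only [toeplitzH, of_apply, Matrix.zero_apply]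
  grind

theorem mul_toeplitzH_apply {m : Type*} {s : ℕ} (Y : Matrix m (Fin s) ℂ) (l : ℕ) (α : m)
    (β : Fin s) :
    (Y * toeplitzH s l) α β = if h : l ≤ β.val then Y α ⟨β.val - l, by omega⟩ else 0 := by
  simp_rw [mul_apply, toeplitzH, of_apply, mul_ite, mul_one, mul_zero]
  split_ifs with h
  · rw [Finset.sum_eq_single ⟨β.val - l, by omega⟩] <;> grind
  · exact Finset.sum_eq_zero fun γ _ => if_neg (by omega)

/-- The coefficient of `aʲ bˡ` in the expansion of `1 / (c + b - a)`, in the form in which it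
enters `blockKbar`. -/
noncomputable def geomCoeff (c : ℂ) (j l : ℕ) : ℂ :=
  (-1 : ℂ) ^ l * ((j + l).factorial : ℂ) / ((j.factorial : ℂ) * (l.factorial : ℂ))
    / c ^ (j + l + 1)

theorem geomCoeff_eq_choose (c : ℂ) (j l : ℕ) :
    geomCoeff c j l = (-1) ^ l * (j + l).choose j / c ^ (j + l + 1) := by
  rw [Nat.cast_add_choose, geomCoeff, mul_div_assoc]

theorem geomCoeff_pascal {c : ℂ} (hc : c ≠ 0) (j l : ℕ) :
    c * geomCoeff c j l + (if l = 0 then 0 else geomCoeff c j (l - 1))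
      - (if j = 0 then 0 else geomCoeff c (j - 1) l) = if j = 0 ∧ l = 0 then 1 else 0 := by
  simp_rw [geomCoeff_eq_choose]
  rcases j with _ | j <;> rcases l with _ | l
  · simp [hc]
  · simp only [zero_add, Nat.choose_zero_right, Nat.cast_one, mul_one, Nat.add_eq_zero_iff,
      one_ne_zero, and_false, ↓reduceIte, add_tsub_cancel_right, sub_zero]
    field_simp
    ring
  · simp only [pow_zero, add_zero, Nat.choose_self, Nat.cast_one, mul_one, one_div, ↓reduceIte,
      Nat.add_eq_zero_iff, one_ne_zero, and_false, add_tsub_cancel_right, and_true]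
    field_simp
    ring
  · have hchoose : (j + 1 + (l + 1)).choose (j + 1) =
        (j + (l + 1)).choose j + (j + 1 + l).choose (j + 1) := by
      rw [show j + 1 + (l + 1) = j + (l + 1) + 1 by ring, Nat.choose_succ_succ]
      grind
    simp only [hchoose, Nat.cast_add, Nat.add_eq_zero_iff, one_ne_zero, and_false, ↓reduceIte,
      add_tsub_cancel_right, and_self]
    field_simp
    ring

theorem sum_range_smul_succ {R E : Type*} [Ring R] [AddCommGroup E] [Module R E] {b : ℕ}
    (g : ℕ → R) {h : ℕ → E} (hb : h b = 0) :
    ∑ l ∈ Finset.range b, g l • h (l + 1) =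
      ∑ l ∈ Finset.range b, (if l = 0 then 0 else g (l - 1)) • h l := by
  have hsucc := Finset.sum_range_succ' (fun l => (if l = 0 then 0 else g (l - 1)) • h l) b
  rw [Finset.sum_range_succ, hb, smul_zero, add_zero] at hsucc
  rw [hsucc]
  simp

theorem sum_geomCoeff_smul {E : Type*} [AddCommGroup E] [Module ℂ E] {a b : ℕ} (ha : 0 < a)
    (hb : 0 < b) {c : ℂ} (hc : c ≠ 0) {f : ℕ → ℕ → E} (hfa : ∀ l, f a l = 0)
    (hfb : ∀ j, f j b = 0) :
    ∑ j ∈ Finset.range a, ∑ l ∈ Finset.range b,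
      geomCoeff c j l • (c • f j l + f j (l + 1) - f (j + 1) l) = f 0 0 := by
  have hshift_l : ∑ j ∈ Finset.range a, ∑ l ∈ Finset.range b, geomCoeff c j l • f j (l + 1) =
      ∑ j ∈ Finset.range a, ∑ l ∈ Finset.range b,
        (if l = 0 then 0 else geomCoeff c j (l - 1)) • f j l :=
    Finset.sum_congr rfl fun j _ => sum_range_smul_succ (geomCoeff c j) (hfb j)
  have hshift_j : ∑ j ∈ Finset.range a, ∑ l ∈ Finset.range b, geomCoeff c j l • f (j + 1) l =
      ∑ j ∈ Finset.range a, ∑ l ∈ Finset.range b,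
        (if j = 0 then 0 else geomCoeff c (j - 1) l) • f j l := by
    rw [Finset.sum_comm, Finset.sum_comm (s := Finset.range a)]
    exact Finset.sum_congr rfl fun l _ =>
      sum_range_smul_succ (fun j => geomCoeff c j l) (h := fun j => f j l) (hfa l)
  simp_rw [smul_sub, smul_add, Finset.sum_sub_distrib, Finset.sum_add_distrib, hshift_l, hshift_j,
    ← Finset.sum_add_distrib, ← Finset.sum_sub_distrib, smul_smul, ← add_smul, ← sub_smul,
    mul_comm (geomCoeff c _ _) c, geomCoeff_pascal hc]
  rw [Finset.sum_eq_single_of_mem 0 (Finset.mem_range.2 ha) fun j _ hj => by simp [hj],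
    Finset.sum_eq_single_of_mem 0 (Finset.mem_range.2 hb) fun l _ hl => by simp [hl]]
  simp

theorem sylvester_sum_geomCoeff {m n : Type*} [Fintype m] [DecidableEq m] [Fintype n]
    [DecidableEq n] {a b : ℕ} (ha : 0 < a) (hb : 0 < b) {L : Matrix m m ℂ} (hL : L ^ a = 0)
    {R : Matrix n n ℂ} (hR : R ^ b = 0) (Q : Matrix m n ℂ) {x y : ℂ} (hxy : x ≠ y)
    {X : Matrix m n ℂ} (hX : X = ∑ j ∈ Finset.range a, ∑ l ∈ Finset.range b,
      geomCoeff (x - y) j l • (L ^ j * Q * R ^ l)) :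
    X * (x • 1 + R) - (y • 1 + L) * X = Q := by
  have hsum := sum_geomCoeff_smul ha hb (sub_ne_zero.2 hxy) (f := fun j l => L ^ j * Q * R ^ l)
    (by simp [hL]) (by simp [hR])
  rw [pow_zero, pow_zero, Matrix.one_mul, Matrix.mul_one] at hsum
  rw [← hsum, hX]
  simp_rw [Matrix.sum_mul, Matrix.mul_sum, ← Finset.sum_sub_distrib]
  refine Finset.sum_congr rfl fun j _ => Finset.sum_congr rfl fun l _ => ?_
  rw [Matrix.smul_mul, Matrix.mul_smul, ← smul_sub, Matrix.mul_add, Matrix.add_mul,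
    Matrix.mul_smul, Matrix.smul_mul, Matrix.mul_one, Matrix.one_mul, sub_smul, pow_succ R,
    pow_succ' L]
  simp only [Matrix.mul_assoc]
  congr 1
  abel

end Sylvester

section BlockDiagonal

variable {R o l : Type*} [NonUnitalNonAssocSemiring R] [Fintype o] [DecidableEq o] {m n : o → Type*}

theorem mul_blockDiagonal'_apply [∀ k, Fintype (m k)] (X : Matrix l (Σ k, m k) R)
    (B : ∀ k, Matrix (m k) (n k) R) (i : l) (k : o) (β : n k) :
    (X * blockDiagonal' B) i ⟨k, β⟩ = (X.submatrix id (Sigma.mk k) * B k) i β := by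
  rw [mul_apply, Fintype.sum_sigma, Finset.sum_eq_single_of_mem k (Finset.mem_univ k)]
  · simp_rw [blockDiagonal'_apply_eq]
    rfl
  · intro k' _ hk
    simp_rw [blockDiagonal'_apply_ne _ _ _ hk, mul_zero, Finset.sum_const_zero]

theorem blockDiagonal'_mul_apply [∀ k, Fintype (n k)] (B : ∀ k, Matrix (m k) (n k) R)
    (X : Matrix (Σ k, n k) l R) (k : o) (α : m k) (j : l) :
    (blockDiagonal' B * X) ⟨k, α⟩ j = (B k * X.submatrix (Sigma.mk k) id) α j := by
  rw [mul_apply, Fintype.sum_sigma, Finset.sum_eq_single_of_mem k (Finset.mem_univ k)]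
  · simp_rw [blockDiagonal'_apply_eq]
    rfl
  · intro k' _ hk
    simp_rw [blockDiagonal'_apply_ne _ _ _ hk.symm, zero_mul, Finset.sum_const_zero]

end BlockDiagonal

namespace ZeroData

variable (D : ZeroData) {N : ℕ}

/-- The same data with the roles of the two zeros of each pair exchanged. -/
abbrev dual : ZeroData where
  NZ := D.NZ
  k := D.kbar
  kbar := D.k
  k_injective := D.kbar_injective
  kbar_injective := D.k_injective
  k_ne_kbar m n := (D.k_ne_kbar n m).symm
  r := D.r
  r_pos := D.r_pos
  s := D.s
  s_pos := D.s_pos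
  s_antitone := D.s_antitone

/-- The block-diagonal matrix `A` of Jordan blocks for which `D(z) = (z - A)⁻¹`. -/
noncomputable def jordan : Matrix D.Idx D.Idx ℂ :=
  blockDiagonal' fun ν : D.Block => jordanBlock (D.size ν) (D.κ ν)

/-- The block-diagonal matrix `Ā` of transposed Jordan blocks for which `D̄(z) = (z - Ā)⁻¹`. -/
noncomputable def jordanBar : Matrix D.Idx D.Idx ℂ := D.dual.jordanᵀ

variable {D}

theorem sub_jordan_mul_poleD {z : ℂ} (hz : z ∉ Set.range D.k) :
    (z • 1 - D.jordan) * D.poleD z = 1 := by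
  have hblock (ν : D.Block) : (z • 1 - jordanBlock (D.size ν) (D.κ ν)) *
      (of fun α β => if α ≤ β then 1 / (z - D.κ ν) ^ (β.val - α.val + 1) else 0) = 1 := by
    have hne : z - D.κ ν ≠ 0 := sub_ne_zero.2 fun h => hz ⟨ν.1, h.symm⟩
    have hpole : (of fun α β => if α ≤ β then 1 / (z - D.κ ν) ^ (β.val - α.val + 1) else 0) =
        toeplitzHom ℂ (D.size ν) (PowerSeries.invUnitsSub (Units.mk0 _ hne)) := by
      ext α β
      simp [toeplitzHom_apply]
    have hz' : (z • 1 : Matrix (Fin (D.size ν)) (Fin (D.size ν)) ℂ) =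
        toeplitzHom ℂ (D.size ν) (PowerSeries.C z) := by
      rw [← PowerSeries.algebraMap_eq, AlgHom.commutes, Algebra.algebraMap_eq_smul_one]
    rw [hpole, hz', jordanBlock_eq_toeplitzHom, ← map_sub, ← map_mul, mul_comm, ← sub_sub,
      ← map_sub]
    exact (congrArg _ (PowerSeries.invUnitsSub_mul_sub (Units.mk0 _ hne))).trans (map_one _)
  rw [jordan, poleD, ← blockDiagonal'_one, ← blockDiagonal'_smul, ← blockDiagonal'_sub,
    ← blockDiagonal'_mul]
  exact congrArg _ (funext hblock)

theorem poleDbar_eq_transpose (z : ℂ) : D.poleDbar z = (D.dual.poleD z)ᵀ := by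
  rw [poleD, blockDiagonal'_transpose]
  rfl

theorem sub_jordanBar_mul_poleDbar {z : ℂ} (hz : z ∉ Set.range D.kbar) :
    (z • 1 - D.jordanBar) * D.poleDbar z = 1 := by
  have hdual := congrArg transpose (mul_eq_one_comm.1 (sub_jordan_mul_poleD (D := D.dual) hz))
  rwa [transpose_mul, transpose_sub, transpose_smul, transpose_one,
    ← poleDbar_eq_transpose] at hdual

end ZeroData

theorem eval_charpoly_ne_zero_of_mul_eq_one {R ι : Type*} [CommRing R] [Nontrivial R] [Fintype ι]
    [DecidableEq ι] {A W : Matrix ι ι R} {z : R} (h : (z • 1 - A) * W = 1) :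
    A.charpoly.eval z ≠ 0 := by
  rw [eval_charpoly, scalar_apply, ← smul_one_eq_diagonal]
  exact det_ne_zero_of_right_inverse h

namespace ZeroData

variable {D : ZeroData} {N : ℕ}

theorem eval_charpoly_jordan_ne_zero {z : ℂ} (hz : z ∉ Set.range D.k) :
    D.jordan.charpoly.eval z ≠ 0 :=
  eval_charpoly_ne_zero_of_mul_eq_one (sub_jordan_mul_poleD hz)

theorem eval_charpoly_jordanBar_ne_zero {z : ℂ} (hz : z ∉ Set.range D.kbar) :
    D.jordanBar.charpoly.eval z ≠ 0 :=
  eval_charpoly_ne_zero_of_mul_eq_one (sub_jordanBar_mul_poleDbar hz)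

theorem notMem_range_kbar (n : Fin D.NZ) : D.k n ∉ Set.range D.kbar :=
  fun ⟨m, hm⟩ => D.k_ne_kbar n m hm.symm

theorem isCoprime_charpoly : IsCoprime D.jordan.charpoly D.jordanBar.charpoly := by
  refine (isCoprime_iff_aeval_ne_zero_of_isAlgClosed ℂ ℂ _ _).2 fun z => ?_
  simp only [coe_aeval_eq_eval]
  by_cases hz : z ∈ Set.range D.k
  · obtain ⟨n, rfl⟩ := hz
    exact Or.inr (eval_charpoly_jordanBar_ne_zero (notMem_range_kbar n))
  · exact Or.inl (eval_charpoly_jordan_ne_zero hz)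

theorem innerQbar_eq_mul (p pbar : D.Vecs N) (ν μ : D.Block) (l : ℕ) :
    innerQbar p pbar ν μ l =
      (of fun α β => pbar ⟨ν, α⟩ ⬝ᵥ p ⟨μ, β⟩) * toeplitzH (D.size μ) l := by
  ext α β
  rw [mul_toeplitzH_apply]
  rfl

theorem blockKbar_sylvester (p pbar : D.Vecs N) (ν μ : D.Block) :
    blockKbar p pbar ν μ * jordanBlock (D.size μ) (D.κ μ) -
      (jordanBlock (D.size ν) (D.κbar ν))ᵀ * blockKbar p pbar ν μ =
      of fun α β => pbar ⟨ν, α⟩ ⬝ᵥ p ⟨μ, β⟩ := by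
  rw [jordanBlock, jordanBlock, transpose_add, transpose_smul, transpose_one]
  refine sylvester_sum_geomCoeff (D.s_pos ν.1 ν.2) (D.s_pos μ.1 μ.2) ?_
    (toeplitzH_one_pow_self _) _ (D.k_ne_kbar μ.1 ν.1) ?_
  · rw [← transpose_pow, toeplitzH_one_pow_self, transpose_zero]
  · refine Finset.sum_congr rfl fun j _ => Finset.sum_congr rfl fun l _ => ?_
    rw [← transpose_pow, toeplitzH_one_pow, toeplitzH_one_pow, toeplitzH_transpose,
      innerQbar_eq_mul, Matrix.mul_assoc]
    rfl

theorem matKbar_sylvester (p pbar : D.Vecs N) :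
    matKbar p pbar * D.jordan - D.jordanBar * matKbar p pbar = rows pbar * cols p := by
  ext ⟨ν, α⟩ ⟨μ, β⟩
  rw [Matrix.sub_apply, jordanBar, jordan, jordan, blockDiagonal'_transpose,
    mul_blockDiagonal'_apply, blockDiagonal'_mul_apply]
  exact congrFun₂ (blockKbar_sylvester p pbar ν μ) α β

theorem innerQ_eq_transpose (p pbar : D.Vecs N) (ν μ : D.Block) (l : ℕ) :
    innerQ p pbar ν μ l = (innerQbar (D := D.dual) pbar p μ ν l)ᵀ := by
  ext α β
  simp only [innerQ, innerQbar, of_apply, transpose_apply]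
  exact ite_congr rfl (fun _ => dotProduct_comm _ _) fun _ => rfl

theorem matKbar_dual (p pbar : D.Vecs N) :
    matKbar (D := D.dual) pbar p = (matK p pbar)ᵀ := by
  have hblock (ν μ : D.Block) :
      blockKbar (D := D.dual) pbar p ν μ = (blockK p pbar μ ν)ᵀ := by
    rw [blockKbar, blockK, Finset.sum_comm]
    simp_rw [transpose_sum, transpose_smul, transpose_mul, innerQ_eq_transpose,
      toeplitzH_transpose, transpose_transpose]
    refine Finset.sum_congr rfl fun l _ => Finset.sum_congr rfl fun j _ => ?_
    rw [add_comm j l, mul_comm (j.factorial : ℂ)]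
    rfl
  ext ⟨ν, α⟩ ⟨μ, β⟩
  exact congrFun₂ (hblock ν μ) α β

end ZeroData

section Degree

variable {R n ι : Type*} [CommRing R] [DecidableEq n] [Fintype ι] [DecidableEq ι]

theorem coeff_adjugate_charmatrix (A : Matrix ι ι R) (i j : ι) {k : ℕ} (hk : Fintype.card ι ≤ k) :
    (adjugate (charmatrix A) i j).coeff k = 0 := by
  nontriviality R
  have : Nonempty ι := ⟨i⟩
  have hmul := congrArg matPolyEquiv (mul_adjugate (charmatrix A))
  rw [map_mul, matPolyEquiv_charmatrix, matPolyEquiv_smul_one, ← charpoly] at hmul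
  rw [← matPolyEquiv_coeff_apply]
  set Q := matPolyEquiv (adjugate (charmatrix A))
  by_cases hQ : Q = 0
  · rw [hQ, coeff_zero, Matrix.zero_apply]
  · have hdeg := (monic_X_sub_C A).natDegree_mul' hQ
    have hle := natDegree_map_le (f := algebraMap R (Matrix ι ι R)) (p := A.charpoly)
    rw [hmul, natDegree_X_sub_C] at hdeg
    rw [charpoly_natDegree_eq_dim] at hle
    rw [coeff_eq_zero_of_natDegree_lt (by omega), Matrix.zero_apply]

variable (A' M : Matrix ι ι R) (P : Matrix n ι R) (P' : Matrix ι n R)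

theorem coeff_dressingNumerator (a b : n) {k : ℕ} (hk : Fintype.card ι ≤ k) :
    (dressingNumerator A' M P P' a b).coeff k = A'.charpoly.coeff k * (1 : Matrix n n R) a b := by
  simp_rw [dressingNumerator, Matrix.sub_apply, coeff_sub, mul_apply (M := (P * M⁻¹).map C),
    finsetSum_coeff, map_apply, coeff_C_mul, mul_apply (M := adjugate _), finsetSum_coeff,
    map_apply, coeff_mul_C, coeff_adjugate_charmatrix A' _ _ hk]
  simp [one_apply, apply_ite (fun f : R[X] => f.coeff k)]

theorem natDegree_dressingNumerator_le [Nontrivial R] (a b : n) :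
    (dressingNumerator A' M P P' a b).natDegree ≤ Fintype.card ι := by
  refine natDegree_le_iff_coeff_eq_zero.2 fun k hk => ?_
  rw [coeff_dressingNumerator _ _ _ _ _ _ hk.le, coeff_eq_zero_of_natDegree_lt, zero_mul]
  rwa [charpoly_natDegree_eq_dim]

theorem coeff_card_dressingNumerator [Nontrivial R] (a b : n) :
    (dressingNumerator A' M P P' a b).coeff (Fintype.card ι) = (1 : Matrix n n R) a b := by
  rw [coeff_dressingNumerator _ _ _ _ _ _ le_rfl, ← charpoly_natDegree_eq_dim A',
    (charpoly_monic A').coeff_natDegree, one_mul]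

theorem map_eval_dressingNumerator {A' W : Matrix ι ι R} {z : R} (hW : (z • 1 - A') * W = 1) :
    (dressingNumerator A' M P P').map (eval z) =
      A'.charpoly.eval z • (1 - P * M⁻¹ * W * P') := by
  have hchar : (charmatrix A').map (evalRingHom z) = z • 1 - A' := by
    ext i j
    simp [charmatrix_apply, diagonal_apply, one_apply, apply_ite]
  have hadj : (adjugate (charmatrix A')).map (evalRingHom z) = A'.charpoly.eval z • W := by
    have hmul := congrArg (adjugate (z • 1 - A') * ·) hW
    simp only [← Matrix.mul_assoc, adjugate_mul, Matrix.smul_mul, Matrix.one_mul,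
      Matrix.mul_one] at hmul
    rw [← RingHom.mapMatrix_apply, RingHom.map_adjugate, RingHom.mapMatrix_apply, hchar,
      eval_charpoly, scalar_apply, ← smul_one_eq_diagonal, hmul]
  have hPM : ((P * M⁻¹).map C).map (evalRingHom z) = P * M⁻¹ := by
    ext
    simp only [map_apply, coe_evalRingHom, eval_C]
  have hP' : (P'.map C).map (evalRingHom z) = P' := by
    ext
    simp only [map_apply, coe_evalRingHom, eval_C]
  have hone : (A'.charpoly • (1 : Matrix n n R[X])).map (evalRingHom z) =
      A'.charpoly.eval z • 1 := by
    ext a b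
    by_cases h : a = b <;> simp [h]
  rw [← coe_evalRingHom, dressingNumerator, Matrix.map_sub _ (map_sub _),
    Matrix.map_mul (L := (P * M⁻¹).map C), Matrix.map_mul (L := adjugate _), hPM, hP', hadj, hone,
    Matrix.smul_mul, Matrix.mul_smul, coe_evalRingHom, smul_sub, ← Matrix.mul_assoc (P * M⁻¹)]

end Degree

section MatrixPolynomials

variable {N s : ℕ}

theorem evalM_apply (F : Matrix (Fin N) (Fin N) ℂ[X]) (z : ℂ) (a b : Fin N) :
    evalM F z a b = (F a b).eval z := rfl

theorem evalM_mul (F G : Matrix (Fin N) (Fin N) ℂ[X]) (z : ℂ) :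
    evalM (F * G) z = evalM F z * evalM G z :=
  Matrix.map_mul (f := evalRingHom z)

theorem evalM_add (F G : Matrix (Fin N) (Fin N) ℂ[X]) (z : ℂ) :
    evalM (F + G) z = evalM F z + evalM G z :=
  Matrix.map_add _ (fun _ _ => eval_add) F G

theorem analyticAt_evalM (F : Matrix (Fin N) (Fin N) ℂ[X]) (z : ℂ) (a b : Fin N) :
    AnalyticAt ℂ (fun w => evalM F w a b) z :=
  (F a b).differentiable.analyticAt z

theorem lowerToeplitz_evalM_one (z : ℂ) :
    lowerToeplitz s (evalM (1 : Matrix (Fin N) (Fin N) ℂ[X])) z = 1 := by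
  ext ⟨i, a⟩ ⟨j, b⟩
  rw [lowerToeplitz_evalM]
  by_cases h : a = b <;> by_cases h' : i = j <;> simp [h, h', one_apply, eq_comm]

/-- The map from matrix polynomials to block-Toeplitz matrices, as an algebra homomorphism. -/
noncomputable def toeplitzAlgHom (s : ℕ) (z : ℂ) :
    Matrix (Fin N) (Fin N) ℂ[X] →ₐ[ℂ] Matrix (Fin s × Fin N) (Fin s × Fin N) ℂ :=
  AlgHom.ofLinearMap
    { toFun := fun F => lowerToeplitz s (evalM F) z
      map_add' := fun F G => by ext i j; simp [lowerToeplitz_evalM]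
      map_smul' := fun c F => by ext i j; simp [lowerToeplitz_evalM] }
    (lowerToeplitz_evalM_one z)
    fun F G => (congrArg (lowerToeplitz s · z) (funext (evalM_mul F G))).trans
      (lowerToeplitz_mul (analyticAt_evalM F z) (analyticAt_evalM G z))

theorem toeplitzAlgHom_apply (z : ℂ) (F : Matrix (Fin N) (Fin N) ℂ[X]) :
    toeplitzAlgHom s z F = lowerToeplitz s (evalM F) z := rfl

theorem upperToeplitz_eq_transpose (F : ℂ → Matrix (Fin N) (Fin N) ℂ) (z : ℂ) :
    upperToeplitz s F z = (lowerToeplitz s (fun w => (F w)ᵀ) z)ᵀ := rfl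

theorem lowerToeplitz_smul_mulVec_eq_zero {f : ℂ → ℂ} {F : ℂ → Matrix (Fin N) (Fin N) ℂ} {z : ℂ}
    (hf : AnalyticAt ℂ f z) (hF : ∀ a b, AnalyticAt ℂ (fun w => F w a b) z)
    {v : Fin s × Fin N → ℂ} (h : lowerToeplitz s F z *ᵥ v = 0) :
    lowerToeplitz s (fun w => f w • F w) z *ᵥ v = 0 := by
  have hscalar (a b : Fin N) :
      AnalyticAt ℂ (fun w => (f w • (1 : Matrix (Fin N) (Fin N) ℂ)) a b) z :=
    hf.mul analyticAt_const
  have hmul := lowerToeplitz_mul (s := s) hscalar hF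
  simp_rw [Matrix.smul_mul, Matrix.one_mul] at hmul
  rw [hmul, ← mulVec_mulVec, h, mulVec_zero]

theorem lowerToeplitz_smul_mulVec_eq_zero_iff {f : ℂ → ℂ} {F : ℂ → Matrix (Fin N) (Fin N) ℂ}
    {z : ℂ} (hf : AnalyticAt ℂ f z) (hf₀ : f z ≠ 0)
    (hF : ∀ a b, AnalyticAt ℂ (fun w => F w a b) z) (v : Fin s × Fin N → ℂ) :
    lowerToeplitz s (fun w => f w • F w) z *ᵥ v = 0 ↔ lowerToeplitz s F z *ᵥ v = 0 := by
  refine ⟨fun h => ?_, lowerToeplitz_smul_mulVec_eq_zero hf hF⟩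
  have hinv := lowerToeplitz_smul_mulVec_eq_zero (hf.fun_inv hf₀)
    (fun a b => hf.fun_mul (hF a b)) h
  rwa [lowerToeplitz_congr (G := F)] at hinv
  filter_upwards [hf.continuousAt.eventually_ne hf₀] with w hw
  exact inv_smul_smul₀ hw (F w)

end MatrixPolynomials

namespace ZeroData

variable {D : ZeroData} {N : ℕ}

/-- The part of `IsPVectors` that concerns the soliton matrix `G` and not its inverse; the part
concerning the inverse is the same condition on its transpose, for the dual data. -/
structure IsDressing (G : ℂ → Matrix (Fin N) (Fin N) ℂ) (p pbar : D.Vecs N) : Prop where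
  isUnit_Kbar : IsUnit (matKbar p pbar).det
  eq_soliton : ∀ z, z ∉ Set.range D.kbar →
    G z = 1 - cols p * (matKbar p pbar)⁻¹ * D.poleDbar z * rows pbar

theorem isPVectors_iff {G Ginv : ℂ → Matrix (Fin N) (Fin N) ℂ} {p pbar : D.Vecs N} :
    IsPVectors G Ginv p pbar ↔ IsDressing G p pbar ∧
      IsDressing (D := D.dual) (fun z => (Ginv z)ᵀ) pbar p := by
  have hform (z : ℂ) : 1 - cols (D := D.dual) pbar * (matKbar (D := D.dual) pbar p)⁻¹ *
      D.dual.poleDbar z * rows (D := D.dual) p =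
        (1 - cols p * D.poleD z * (matK p pbar)⁻¹ * rows pbar)ᵀ := by
    simp only [transpose_sub, transpose_one, transpose_mul, matKbar_dual, transpose_nonsing_inv,
      poleDbar_eq_transpose, Matrix.mul_assoc]
    rfl
  have hdet : (matKbar (D := D.dual) pbar p).det = (matK p pbar).det := by
    rw [matKbar_dual, det_transpose]
  exact ⟨fun h => ⟨⟨h.1, h.3⟩, ⟨hdet ▸ h.2, fun z hz => (congrArg _ (h.4 z hz)).trans
      (hform z).symm⟩⟩,
    fun h => ⟨h.1.1, hdet ▸ h.2.1, h.1.2, fun z hz => transpose_injective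
      ((h.2.2 z hz).trans (hform z))⟩⟩

/-- The soliton matrix multiplied by its denominator `det (X - Ā)`. -/
noncomputable def numerator (p pbar : D.Vecs N) : Matrix (Fin N) (Fin N) ℂ[X] :=
  dressingNumerator D.jordanBar (matKbar p pbar) (cols p) (rows pbar)

theorem IsDressing.evalM_numerator {G : ℂ → Matrix (Fin N) (Fin N) ℂ} {p pbar : D.Vecs N}
    (h : IsDressing G p pbar) {z : ℂ} (hz : z ∉ Set.range D.kbar) :
    evalM (numerator p pbar) z = D.jordanBar.charpoly.eval z • G z := by
  rw [h.eq_soliton z hz]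
  exact map_eval_dressingNumerator _ _ _ (sub_jordanBar_mul_poleDbar hz)

theorem aeval_jordan (f : ℂ[X]) : aeval D.jordan f =
    blockDiagonal' fun ν : D.Block => aeval (jordanBlock (D.size ν) (D.κ ν)) f := by
  induction f using Polynomial.induction_on' with
  | add f g hf hg =>
    simp_rw [map_add, hf, hg, ← blockDiagonal'_add]
    rfl
  | monomial k c =>
    simp_rw [aeval_monomial, jordan, ← blockDiagonal'_pow, ← Algebra.smul_def,
      ← blockDiagonal'_smul]
    rfl

theorem polyAct_jordan_apply (F : Matrix (Fin N) (Fin N) ℂ[X]) (p : D.Vecs N) (a : Fin N)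
    (ν : D.Block) (i : Fin (D.size ν)) :
    polyAct D.jordan F (cols p) a ⟨ν, i⟩ =
      (lowerToeplitz (D.size ν) (evalM F) (D.κ ν) *ᵥ stack ν p) (i, a) := by
  simp_rw [polyAct_apply, aeval_jordan, mul_blockDiagonal'_apply, mulVec, dotProduct,
    lowerToeplitz_evalM, mul_apply, Fintype.sum_prod_type]
  rw [Finset.sum_comm]
  exact Finset.sum_congr rfl fun _ _ => Finset.sum_congr rfl fun _ _ => mul_comm _ _

theorem polyAct_jordan_eq_zero_iff (F : Matrix (Fin N) (Fin N) ℂ[X]) (p : D.Vecs N) :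
    polyAct D.jordan F (cols p) = 0 ↔ KernelEq (evalM F) p := by
  refine ⟨fun h ν => funext fun ⟨i, a⟩ => ?_, fun h => ?_⟩
  · rw [← polyAct_jordan_apply, h]
    rfl
  · ext a ⟨ν, i⟩
    rw [polyAct_jordan_apply, h]
    rfl

/-- The system of vectors that has `P` as the matrix of its columns. -/
def ofCols (P : Matrix (Fin N) D.Idx ℂ) : D.Vecs N := fun i a => P a i

theorem bracket_eq_stack (A : Matrix (Fin N) (Fin N) ℂ[X]) (dp p : D.Vecs N) (ν : D.Block) :
    bracket A dp p ν = stack ν (ofCols (cols dp + polyAct D.jordan A (cols p))) :=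
  funext fun ⟨i, a⟩ => congrArg (dp ⟨ν, i⟩ a + ·) (polyAct_jordan_apply A p a ν i).symm

namespace IsDressing

variable {G : ℂ → Matrix (Fin N) (Fin N) ℂ} {p pbar : D.Vecs N}

theorem kernelEq_iff_polyAct (h : IsDressing G p pbar) (v : D.Vecs N) :
    KernelEq G v ↔ polyAct D.jordan (numerator p pbar) (cols v) = 0 := by
  rw [polyAct_jordan_eq_zero_iff]
  refine forall_congr' fun ν => ?_
  have hκ : D.κ ν ∉ Set.range D.kbar := notMem_range_kbar ν.1
  have hG : G =ᶠ[𝓝 (D.κ ν)] fun z =>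
      (D.jordanBar.charpoly.eval z)⁻¹ • evalM (numerator p pbar) z := by
    filter_upwards [(Set.finite_range D.kbar).isClosed.isOpen_compl.mem_nhds hκ] with z hz
    rw [h.evalM_numerator hz, inv_smul_smul₀ (eval_charpoly_jordanBar_ne_zero hz)]
  have hq := eval_charpoly_jordanBar_ne_zero hκ
  rw [lowerToeplitz_congr hG]
  exact lowerToeplitz_smul_mulVec_eq_zero_iff
    ((D.jordanBar.charpoly.differentiable.analyticAt _).fun_inv hq) (inv_ne_zero hq)
    (analyticAt_evalM _ _) _

theorem kernelEq_iff (h : IsDressing G p pbar) (v : D.Vecs N) :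
    KernelEq G v ↔ ∃ B, Commute D.jordan B ∧ cols v = cols p * B := by
  rw [h.kernelEq_iff_polyAct]
  refine ⟨exists_commute_of_polyAct_dressingNumerator_eq_zero isCoprime_charpoly h.isUnit_Kbar
    (matKbar_sylvester p pbar), ?_⟩
  rintro ⟨B, hB, hv⟩
  rw [hv]
  exact polyAct_dressingNumerator_mul_eq_zero h.isUnit_Kbar (matKbar_sylvester p pbar) hB

theorem kernelEq (h : IsDressing G p pbar) : KernelEq G p :=
  (h.kernelEq_iff p).2 ⟨1, Commute.one_right _, (Matrix.mul_one _).symm⟩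

theorem forall_bracket_iff (h : IsDressing G p pbar) (A : Matrix (Fin N) (Fin N) ℂ[X])
    (dv v : D.Vecs N) :
    (∀ ν, lowerToeplitz (D.size ν) G (D.κ ν) *ᵥ bracket A dv v ν = 0) ↔
      polyAct D.jordan (numerator p pbar) (cols dv + polyAct D.jordan A (cols v)) = 0 := by
  simp_rw [bracket_eq_stack]
  exact h.kernelEq_iff_polyAct (ofCols (cols dv + polyAct D.jordan A (cols v)))

end IsDressing

theorem isLaxFamily_numerator {lam : Matrix (Fin N) (Fin N) ℂ[X]}
    {G : ℝ → ℂ → Matrix (Fin N) (Fin N) ℂ} {U : ℝ → Matrix (Fin N) (Fin N) ℂ[X]}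
    {p pbar : ℝ → D.Vecs N} (h : ∀ x, IsDressing (G x) (p x) (pbar x))
    (hG : ∀ x z, z ∉ Set.range D.k → z ∉ Set.range D.kbar → ∀ a b,
      HasDerivAt (fun y => G y z a b) ((G x z * evalM lam z + evalM (U x) z * G x z) a b) x) :
    IsLaxFamily (Fintype.card D.Idx) lam (fun x => numerator (p x) (pbar x)) U where
  natDegree_le x a b := natDegree_dressingNumerator_le _ _ _ _ a b
  coeff_eq_one x := Matrix.ext fun a b => coeff_card_dressingNumerator _ _ _ _ a b
  hasDerivAt x a b := by
    refine hasDerivAt_linearMap_of_eval (d := Fintype.card D.Idx)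
      (fun y => natDegree_dressingNumerator_le _ _ _ _ a b)
      ((Set.finite_range D.k).union (Set.finite_range D.kbar)).infinite_compl fun z hz => ?_
    rw [Set.mem_compl_iff, Set.mem_union, not_or] at hz
    have hvalue : evalM (numerator (p x) (pbar x) * lam + U x * numerator (p x) (pbar x)) z =
        D.jordanBar.charpoly.eval z • (G x z * evalM lam z + evalM (U x) z * G x z) := by
      rw [evalM_add, evalM_mul, evalM_mul, (h x).evalM_numerator hz.2,
        Matrix.mul_smul, Matrix.smul_mul, ← smul_add]
    simp_rw [← evalM_apply, hvalue, (h _).evalM_numerator hz.2]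
    exact (hG x z hz.1 hz.2 a b).const_mul _

end ZeroData

section MatrixExponential

open scoped Matrix.Norms.Operator

variable {n : Type*} [Fintype n] [DecidableEq n]

theorem norm_entry_le (A : Matrix n n ℂ) (a b : n) : ‖A a b‖ ≤ ‖A‖ := by
  rw [linfty_opNorm_def]
  have hrow := Finset.le_sup (f := fun i => ∑ j, ‖A i j‖₊) (Finset.mem_univ a)
  have hentry := Finset.single_le_sum (f := fun j => ‖A a j‖₊) (fun _ _ => zero_le)
    (Finset.mem_univ b)
  exact_mod_cast hentry.trans hrow

theorem hasSum_exp_apply (A : Matrix n n ℂ) (a b : n) :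
    HasSum (fun k => (k.factorial : ℂ)⁻¹ * (A ^ k) a b) (NormedSpace.exp A a b) :=
  (NormedSpace.exp_series_hasSum_exp' (𝕂 := ℂ) A).map (entryAddMonoidHom ℂ a b)
    (continuous_id.matrix_elem a b)

theorem tendstoLocallyUniformlyOn_sum_exp {F : ℂ → Matrix n n ℂ} (hF : Continuous F) (a b : n) :
    TendstoLocallyUniformlyOn
      (fun m z => ∑ k ∈ Finset.range m, (k.factorial : ℂ)⁻¹ * (F z ^ k) a b)
      (fun z => NormedSpace.exp (F z) a b) Filter.atTop Set.univ := by
  have : Nonempty n := ⟨a⟩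
  rw [tendstoLocallyUniformlyOn_iff_forall_isCompact isOpen_univ]
  intro K _ hK
  obtain ⟨c, hc⟩ := hK.bddAbove_image (f := fun z => ‖F z‖) hF.norm.continuousOn
  have hbound (k : ℕ) (z : ℂ) (hz : z ∈ K) :
      ‖(k.factorial : ℂ)⁻¹ * (F z ^ k) a b‖ ≤ c ^ k / k.factorial := by
    rw [norm_mul, norm_inv, Complex.norm_natCast, div_eq_inv_mul]
    gcongr
    calc ‖(F z ^ k) a b‖ ≤ ‖F z ^ k‖ := norm_entry_le _ a b
      _ ≤ ‖F z‖ ^ k := norm_pow_le _ k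
      _ ≤ c ^ k := pow_le_pow_left₀ (norm_nonneg _) (hc ⟨z, hz, rfl⟩) k
  exact (tendstoUniformlyOn_tsum_nat (Real.summable_pow_div_factorial c) hbound).congr_right
    fun z _ => (hasSum_exp_apply (F z) a b).tsum_eq

theorem hasDerivAt_matrix_inverse {A B : ℝ → Matrix n n ℂ} {A' : Matrix n n ℂ} {x : ℝ}
    (hAB : ∀ y, A y * B y = 1) (hA : HasDerivAt A A' x) :
    HasDerivAt B (-(B x * A' * B x)) x := by
  let u (y : ℝ) : (Matrix n n ℂ)ˣ := ⟨A y, B y, hAB y, mul_eq_one_comm.1 (hAB y)⟩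
  have hB : Ring.inverse ∘ A = B := funext fun y => Ring.inverse_unit (u y)
  have hderiv := (hasFDerivAt_ringInverse (𝕜 := ℝ) (u x)).comp_hasDerivAt x hA
  rwa [hB] at hderiv

theorem exp_mul_exp_neg (A : Matrix n n ℂ) : NormedSpace.exp A * NormedSpace.exp (-A) = 1 := by
  rw [← Matrix.exp_add_of_commute _ _ (Commute.refl A).neg_right, add_neg_cancel,
    NormedSpace.exp_zero]

theorem hasDerivAt_exp_mulVec {L O : Matrix n n ℂ} (hLO : Commute L O) (v : n → ℂ) (x t : ℝ) :
    HasDerivAt (fun y : ℝ => NormedSpace.exp (-((y : ℂ) • L) - (t : ℂ) • O) *ᵥ v)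
      (-L *ᵥ (NormedSpace.exp (-((x : ℂ) • L) - (t : ℂ) • O) *ᵥ v)) x := by
  have hsplit (y : ℝ) : NormedSpace.exp (-((y : ℂ) • L) - (t : ℂ) • O) =
      NormedSpace.exp (y • -L) * NormedSpace.exp (-((t : ℂ) • O)) := by
    rw [sub_eq_add_neg, Matrix.exp_add_of_commute _ _
      (((hLO.smul_left (y : ℂ)).smul_right (t : ℂ)).neg_left.neg_right), smul_neg,
      Complex.coe_smul]
  have hexp := hasDerivAt_matrix.1 (hasDerivAt_exp_smul_const' (𝕂 := ℝ) (-L) x)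
  simp_rw [hsplit, ← mulVec_mulVec]
  rw [mulVec_mulVec _ (-L)]
  exact hasDerivAt_pi.2 fun i => .fun_sum fun j _ => (hexp i j).mul_const _

theorem hasDerivAt_exp_mulVec_snd {L O : Matrix n n ℂ} (hLO : Commute L O) (v : n → ℂ)
    (x t : ℝ) :
    HasDerivAt (fun τ : ℝ => NormedSpace.exp (-((x : ℂ) • L) - (τ : ℂ) • O) *ᵥ v)
      (-O *ᵥ (NormedSpace.exp (-((x : ℂ) • L) - (t : ℂ) • O) *ᵥ v)) t := by
  simp_rw [fun τ : ℝ => neg_sub_comm ((x : ℂ) • L) ((τ : ℂ) • O)]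
  exact hasDerivAt_exp_mulVec hLO.symm v t x

theorem eq_exp_mulVec {L O : Matrix n n ℂ} (hLO : Commute L O) {v : ℝ → ℝ → n → ℂ}
    (hx : ∀ x t, HasDerivAt (fun y => v y t) (-L *ᵥ v x t) x)
    (ht : ∀ x t, HasDerivAt (fun τ => v x τ) (-O *ᵥ v x t) t) (x t : ℝ) :
    v x t = NormedSpace.exp (-((x : ℂ) • L) - (t : ℂ) • O) *ᵥ v 0 0 := by
  let T (A : Matrix n n ℂ) : (n → ℂ) →L[ℝ] (n → ℂ) :=
    LinearMap.toContinuousLinearMap ((mulVecLin A).restrictScalars ℝ)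
  let w (x t : ℝ) : n → ℂ := v x t - NormedSpace.exp (-((x : ℂ) • L) - (t : ℂ) • O) *ᵥ v 0 0
  have hwx (x : ℝ) : HasDerivAt (fun y => w y 0) (T (-L) (w x 0)) x :=
    ((hx x 0).sub (hasDerivAt_exp_mulVec hLO _ x 0)).congr_deriv (mulVec_sub _ _ _).symm
  have hwt (t : ℝ) : HasDerivAt (w x) (T (-O) (w x t)) t :=
    ((ht x t).sub (hasDerivAt_exp_mulVec_snd hLO _ x t)).congr_deriv (mulVec_sub _ _ _).symm
  have hw₀ : w 0 0 = 0 := by simp [w]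
  have haxis : w x 0 = 0 := eq_zero_of_hasDerivAt_clm continuous_const hwx hw₀ x
  exact sub_eq_zero.1 (eq_zero_of_hasDerivAt_clm continuous_const hwt haxis t)

end MatrixExponential

theorem tendsto_iteratedDeriv {f : ℕ → ℂ → ℂ} {g : ℂ → ℂ}
    (h : TendstoLocallyUniformlyOn f g Filter.atTop Set.univ) (hf : ∀ m, Differentiable ℂ (f m))
    (k : ℕ) (z : ℂ) :
    Filter.Tendsto (fun m => iteratedDeriv k (f m) z) Filter.atTop (𝓝 (iteratedDeriv k g z)) := by
  suffices hk : TendstoLocallyUniformlyOn (fun m => iteratedDeriv k (f m)) (iteratedDeriv k g)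
      Filter.atTop Set.univ ∧ ∀ m, Differentiable ℂ (iteratedDeriv k (f m)) from
    hk.1.tendsto_at (Set.mem_univ z)
  induction k with
  | zero => simpa using ⟨h, hf⟩
  | succ k ih =>
    simp_rw [iteratedDeriv_succ]
    exact ⟨ih.1.deriv (.of_forall fun m => (ih.2 m).differentiableOn) isOpen_univ,
      fun m => differentiableOn_univ.1 ((ih.2 m).differentiableOn.deriv isOpen_univ)⟩

section ToeplitzExponential

variable {N s : ℕ}

/-- The partial sums of the exponential series, which for a matrix polynomial are matrix
polynomials again. -/
noncomputable def expTrunc (F : Matrix (Fin N) (Fin N) ℂ[X]) (m : ℕ) :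
    Matrix (Fin N) (Fin N) ℂ[X] :=
  ∑ k ∈ Finset.range m, (k.factorial : ℂ)⁻¹ • F ^ k

theorem eval_expTrunc_apply (F : Matrix (Fin N) (Fin N) ℂ[X]) (m : ℕ) (z : ℂ) (a b : Fin N) :
    (expTrunc F m a b).eval z =
      ∑ k ∈ Finset.range m, (k.factorial : ℂ)⁻¹ * (evalM F z ^ k) a b := by
  have hpow (k : ℕ) : evalM F z ^ k = evalM (F ^ k) z :=
    (map_pow (evalRingHom z).mapMatrix F k).symm
  simp [expTrunc, Matrix.sum_apply, eval_finsetSum, hpow, evalM_apply]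

theorem tendsto_lowerToeplitz_expTrunc_apply (F : Matrix (Fin N) (Fin N) ℂ[X]) (z : ℂ)
    (i j : Fin s × Fin N) :
    Filter.Tendsto (fun m => lowerToeplitz s (evalM (expTrunc F m)) z i j) Filter.atTop
      (𝓝 (NormedSpace.exp (lowerToeplitz s (evalM F) z) i j)) := by
  have hsum (m : ℕ) : lowerToeplitz s (evalM (expTrunc F m)) z i j = ∑ k ∈ Finset.range m,
      (k.factorial : ℂ)⁻¹ * (lowerToeplitz s (evalM F) z ^ k) i j := by
    rw [← toeplitzAlgHom_apply, ← toeplitzAlgHom_apply, expTrunc, map_sum, Matrix.sum_apply]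
    simp_rw [map_smul, map_pow]
    rfl
  simp_rw [hsum]
  exact (hasSum_exp_apply _ i j).tendsto_sum_nat

theorem exp_lowerToeplitz (F : Matrix (Fin N) (Fin N) ℂ[X]) (z : ℂ) :
    NormedSpace.exp (lowerToeplitz s (evalM F) z) =
      lowerToeplitz s (fun w => NormedSpace.exp (evalM F w)) z := by
  have hcont : Continuous (evalM F) := continuous_matrix fun a b => (F a b).continuous
  ext i j
  refine tendsto_nhds_unique (tendsto_lowerToeplitz_expTrunc_apply F z i j) ?_
  simp only [lowerToeplitz, of_apply]
  split_ifs
  · refine (tendsto_iteratedDeriv ?_ (fun m => (expTrunc F m i.2 j.2).differentiable) _ z).div_const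
      _
    simp_rw [eval_expTrunc_apply]
    exact tendstoLocallyUniformlyOn_sum_exp hcont i.2 j.2
  · exact tendsto_const_nhds

end ToeplitzExponential

namespace ZeroData

variable {D : ZeroData} {N : ℕ} {lam om : Matrix (Fin N) (Fin N) ℂ[X]}

theorem commute_lowerToeplitz (hcomm : Commute lam om) (s : ℕ) (z : ℂ) :
    Commute (lowerToeplitz s (evalM lam) z) (lowerToeplitz s (evalM om) z) :=
  hcomm.map (toeplitzAlgHom s z)

theorem propagator_eq_exp_lowerToeplitz (x t : ℝ) (ν : D.Block) :
    propagator lam om x t ν = NormedSpace.exp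
      (lowerToeplitz (D.size ν) (evalM (-((x : ℂ) • lam) - (t : ℂ) • om)) (D.κ ν)) := by
  simp only [propagator, ← toeplitzAlgHom_apply, map_sub, map_neg, map_smul]

theorem stack_evolve (p0 : D.Vecs N) (x t : ℝ) (ν : D.Block) :
    stack ν (evolve lam om p0 x t) = propagator lam om x t ν *ᵥ stack ν p0 := rfl

theorem ext_stack {p p' : D.Vecs N} (h : ∀ ν, stack ν p = stack ν p') : p = p' :=
  funext₂ fun ⟨ν, i⟩ a => congrFun (h ν) (i, a)

theorem hasDerivAt_evolve (hcomm : Commute lam om) (p0 : D.Vecs N) (x t : ℝ) (i : D.Idx)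
    (a : Fin N) :
    HasDerivAt (fun y => evolve lam om p0 y t i a)
        (-(lowerToeplitz (D.size i.1) (evalM lam) (D.κ i.1) *ᵥ
          stack i.1 (evolve lam om p0 x t)) (i.2, a)) x ∧
      HasDerivAt (fun τ => evolve lam om p0 x τ i a)
        (-(lowerToeplitz (D.size i.1) (evalM om) (D.κ i.1) *ᵥ
          stack i.1 (evolve lam om p0 x t)) (i.2, a)) t := by
  have hcomm' := commute_lowerToeplitz hcomm (D.size i.1) (D.κ i.1)
  have hx := hasDerivAt_pi.1 (hasDerivAt_exp_mulVec hcomm' (stack i.1 p0) x t) (i.2, a)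
  have ht := hasDerivAt_pi.1 (hasDerivAt_exp_mulVec_snd hcomm' (stack i.1 p0) x t) (i.2, a)
  rw [neg_mulVec] at hx ht
  exact ⟨hx, ht⟩

theorem partialDiff_evolve (hcomm : Commute lam om) (p0 : D.Vecs N) :
    PartialDiff (evolve lam om p0) := fun x t i a =>
  ⟨(hasDerivAt_evolve hcomm p0 x t i a).1.differentiableAt,
    (hasDerivAt_evolve hcomm p0 x t i a).2.differentiableAt⟩

theorem evolutionEq_evolve (hcomm : Commute lam om) (p0 : D.Vecs N) :
    EvolutionEq lam om (evolve lam om p0) := by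
  refine fun x t ν => ⟨funext fun ⟨i, a⟩ => ?_, funext fun ⟨i, a⟩ => ?_⟩
  · exact (congrArg (· + _) (hasDerivAt_evolve hcomm p0 x t ⟨ν, i⟩ a).1.deriv).trans
      (neg_add_cancel _)
  · exact (congrArg (· + _) (hasDerivAt_evolve hcomm p0 x t ⟨ν, i⟩ a).2.deriv).trans
      (neg_add_cancel _)

theorem eq_evolve (hcomm : Commute lam om) {p : ℝ → ℝ → D.Vecs N} (hp : PartialDiff p)
    (he : EvolutionEq lam om p) (x t : ℝ) : p x t = evolve lam om (p 0 0) x t := by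
  refine ext_stack fun ν => eq_exp_mulVec (commute_lowerToeplitz hcomm (D.size ν) (D.κ ν))
    (v := fun x t => stack ν (p x t)) (fun x t => ?_) (fun x t => ?_) x t
  · rw [neg_mulVec, ← eq_neg_of_add_eq_zero_left (he x t ν).1]
    exact hasDerivAt_pi.2 fun j => (hp x t ⟨ν, j.1⟩ j.2).1.hasDerivAt
  · rw [neg_mulVec, ← eq_neg_of_add_eq_zero_left (he x t ν).2]
    exact hasDerivAt_pi.2 fun j => (hp x t ⟨ν, j.1⟩ j.2).2.hasDerivAt

theorem evolution_iff (hcomm : Commute lam om) (p : ℝ → ℝ → D.Vecs N) :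
    (PartialDiff p ∧ EvolutionEq lam om p) ↔
      ∃ p0 : D.Vecs N, ∀ x t, p x t = evolve lam om p0 x t := by
  refine ⟨fun h => ⟨p 0 0, eq_evolve hcomm h.1 h.2⟩, fun ⟨p0, h⟩ => ?_⟩
  obtain rfl : p = evolve lam om p0 := funext₂ h
  exact ⟨partialDiff_evolve hcomm p0, evolutionEq_evolve hcomm p0⟩

theorem evolve_zero (p0 : D.Vecs N) : evolve lam om p0 0 0 = p0 :=
  ext_stack fun ν => by simp [stack_evolve, propagator]

theorem propagator_mul_propagator_neg (x t : ℝ) (ν : D.Block) :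
    propagator lam om x t ν * propagator lam om (-x) (-t) ν = 1 := by
  refine Eq.trans (congrArg (fun A => propagator lam om x t ν * NormedSpace.exp A) ?_)
    (exp_mul_exp_neg _)
  simp only [Complex.ofReal_neg, neg_smul, neg_sub', sub_neg_eq_add]

theorem evolve_evolve_neg (p0 : D.Vecs N) (x t : ℝ) :
    evolve lam om (evolve lam om p0 (-x) (-t)) x t = p0 :=
  ext_stack fun ν => by
    rw [stack_evolve, stack_evolve, mulVec_mulVec, propagator_mul_propagator_neg, one_mulVec]

theorem tendsto_polyAct_expTrunc (p0 : D.Vecs N) (x t : ℝ) :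
    Filter.Tendsto
      (fun m => polyAct D.jordan (expTrunc (-((x : ℂ) • lam) - (t : ℂ) • om) m) (cols p0))
      Filter.atTop (𝓝 (cols (evolve lam om p0 x t))) := by
  refine tendsto_pi_nhds.2 fun a => tendsto_pi_nhds.2 fun ⟨ν, i⟩ => ?_
  simp_rw [polyAct_jordan_apply]
  change Filter.Tendsto _ _ (𝓝 ((propagator lam om x t ν *ᵥ stack ν p0) (i, a)))
  rw [propagator_eq_exp_lowerToeplitz]
  exact tendsto_finsetSum _ fun j _ =>
    (tendsto_lowerToeplitz_expTrunc_apply _ _ (i, a) j).mul_const _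

theorem cols_evolve_eq_mul {p0 p1 : D.Vecs N} {B : Matrix D.Idx D.Idx ℂ}
    (hB : Commute D.jordan B) (h : cols p1 = cols p0 * B) (x t : ℝ) :
    cols (evolve lam om p1 x t) = cols (evolve lam om p0 x t) * B := by
  refine tendsto_nhds_unique (tendsto_polyAct_expTrunc p1 x t) ?_
  simp_rw [h, polyAct_mul_right hB]
  exact ((continuous_id.matrix_mul continuous_const).tendsto _).comp
    (tendsto_polyAct_expTrunc p0 x t)

end ZeroData

theorem evalM_neg_transpose {N : ℕ} (F : Matrix (Fin N) (Fin N) ℂ[X]) (z : ℂ) :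
    evalM (-Fᵀ) z = -(evalM F z)ᵀ := by
  ext a b
  exact eval_neg _ _

theorem lowerToeplitz_evalM_neg_transpose {N : ℕ} (s : ℕ) (F : Matrix (Fin N) (Fin N) ℂ[X])
    (z : ℂ) : lowerToeplitz s (evalM (-Fᵀ)) z = -(upperToeplitz s (evalM F) z)ᵀ := by
  rw [← toeplitzAlgHom_apply, map_neg]
  rfl

theorem commute_transpose_iff {n R : Type*} [Fintype n] [CommSemiring R] {A B : Matrix n n R} :
    Commute Aᵀ Bᵀ ↔ Commute A B := by
  rw [commute_iff_eq, commute_iff_eq, ← transpose_mul, ← transpose_mul, transpose_inj, eq_comm]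

theorem commute_neg_transpose {n R : Type*} [Fintype n] [CommRing R] {A B : Matrix n n R}
    (h : Commute A B) : Commute (-Aᵀ) (-Bᵀ) :=
  (commute_transpose_iff.2 h).neg_left.neg_right

namespace ZeroData

variable {D : ZeroData} {N : ℕ}

section Duality

theorem kernelEqBar_iff_dual (Ginv : ℂ → Matrix (Fin N) (Fin N) ℂ) (pbar : D.Vecs N) :
    KernelEqBar Ginv pbar ↔ KernelEq (D := D.dual) (fun z => (Ginv z)ᵀ) pbar := by
  refine forall_congr' fun ν => ?_
  rw [upperToeplitz_eq_transpose, vecMul_transpose]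
  rfl

theorem bracketBar_eq_dual (A : Matrix (Fin N) (Fin N) ℂ[X]) (dp pbar : D.Vecs N) (ν : D.Block) :
    bracketBar A dp pbar ν = bracket (D := D.dual) (-Aᵀ) dp pbar ν := by
  have hToeplitz : lowerToeplitz (D.dual.size ν) (evalM (-Aᵀ)) (D.dual.κ ν) =
      -(upperToeplitz (D.size ν) (evalM A) (D.κbar ν))ᵀ := lowerToeplitz_evalM_neg_transpose _ _ _
  rw [bracketBar, bracket, hToeplitz, neg_mulVec, mulVec_transpose, sub_eq_add_neg]
  rfl

variable (lam om : Matrix (Fin N) (Fin N) ℂ[X])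

theorem derivedEqBar_iff_dual (Ginv : ℝ → ℝ → ℂ → Matrix (Fin N) (Fin N) ℂ)
    (pbar : ℝ → ℝ → D.Vecs N) :
    DerivedEqBar lam om Ginv pbar ↔
      DerivedEq (D := D.dual) (-lamᵀ) (-omᵀ) (fun x t z => (Ginv x t z)ᵀ) pbar := by
  refine forall_congr' fun x => forall_congr' fun t => forall_congr' fun ν => ?_
  rw [upperToeplitz_eq_transpose, vecMul_transpose, vecMul_transpose, bracketBar_eq_dual,
    bracketBar_eq_dual]
  rfl

theorem evolutionEqBar_iff_dual (pbar : ℝ → ℝ → D.Vecs N) :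
    EvolutionEqBar lam om pbar ↔ EvolutionEq (D := D.dual) (-lamᵀ) (-omᵀ) pbar := by
  refine forall_congr' fun x => forall_congr' fun t => forall_congr' fun ν => ?_
  rw [bracketBar_eq_dual, bracketBar_eq_dual]
  rfl

theorem propagatorBar_eq_dual (x t : ℝ) (ν : D.Block) :
    propagatorBar lam om x t ν = (propagator (D := D.dual) (-lamᵀ) (-omᵀ) x t ν)ᵀ := by
  rw [propagator, lowerToeplitz_evalM_neg_transpose, lowerToeplitz_evalM_neg_transpose,
    ← Matrix.exp_transpose, smul_neg, smul_neg, neg_neg, sub_neg_eq_add]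
  rfl

theorem evolveBar_eq_dual (pbar0 : D.Vecs N) (x t : ℝ) :
    evolveBar lam om pbar0 x t = evolve (D := D.dual) (-lamᵀ) (-omᵀ) pbar0 x t := by
  funext i a
  rw [evolveBar, propagatorBar_eq_dual, vecMul_transpose]
  rfl

variable {lam om}

theorem evolutionBar_iff (hcomm : Commute lam om) (pbar : ℝ → ℝ → D.Vecs N) :
    (PartialDiff pbar ∧ EvolutionEqBar lam om pbar) ↔
      ∃ pbar0 : D.Vecs N, ∀ x t, pbar x t = evolveBar lam om pbar0 x t := by
  rw [evolutionEqBar_iff_dual]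
  simp_rw [evolveBar_eq_dual]
  exact evolution_iff (D := D.dual) (commute_neg_transpose hcomm) pbar

end Duality

section Exponentials

variable (lam om : Matrix (Fin N) (Fin N) ℂ[X]) (x t : ℝ)

theorem propagator_eq_lowerToeplitz (ν : D.Block) :
    propagator lam om x t ν = lowerToeplitz (D.size ν) (expE lam om x t) (D.κ ν) := by
  rw [propagator_eq_exp_lowerToeplitz, exp_lowerToeplitz]
  congr! 2 with z
  refine congrArg NormedSpace.exp (Matrix.ext fun a b => ?_)
  simp [evalM_apply]

theorem propagatorBar_eq_upperToeplitz (ν : D.Block) :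
    propagatorBar lam om x t ν =
      upperToeplitz (D.size ν) (fun z => (expE lam om x t z)⁻¹) (D.κbar ν) := by
  have hdual : expE (-lamᵀ) (-omᵀ) x t = fun z => ((expE lam om x t z)⁻¹)ᵀ := by
    funext z
    rw [expE, expE, evalM_neg_transpose, evalM_neg_transpose, ← Matrix.exp_neg,
      ← Matrix.exp_transpose]
    simp only [smul_neg, neg_sub', transpose_sub, transpose_neg, transpose_smul]
  rw [propagatorBar_eq_dual, propagator_eq_lowerToeplitz, upperToeplitz_eq_transpose, hdual]
  rfl

end Exponentials

end ZeroData

theorem commute_iff_of_sub_mul_eq_one {R ι : Type*} [CommRing R] [Fintype ι] [DecidableEq ι]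
    {A B W : Matrix ι ι R} {z : R} (h : (z • 1 - A) * W = 1) : Commute B W ↔ Commute A B := by
  let u : (Matrix ι ι R)ˣ := ⟨z • 1 - A, W, h, mul_eq_one_comm.1 h⟩
  have hz : Commute B (z • 1) := (Commute.one_right B).smul_right z
  have hresolvent : Commute B (z • 1 - A) ↔ Commute A B :=
    ⟨fun hB => (sub_sub_cancel (z • 1) A ▸ hz.sub_right hB).symm, fun hB => hz.sub_right hB.symm⟩
  exact (Commute.units_inv_right_iff (u := u)).trans hresolvent

namespace ZeroData

variable {D : ZeroData} {N : ℕ}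

section Invariance

theorem isInvariance_iff {B : Matrix D.Idx D.Idx ℂ} :
    D.IsInvariance B ↔ IsUnit B.det ∧ Commute D.jordan B := by
  refine and_congr_right fun _ => ⟨fun h => ?_, fun h z hz =>
    (commute_iff_of_sub_mul_eq_one (sub_jordan_mul_poleD hz)).2 h⟩
  obtain ⟨z, hz⟩ := (Set.finite_range D.k).exists_notMem
  exact (commute_iff_of_sub_mul_eq_one (sub_jordan_mul_poleD hz)).1 (h z hz)

theorem isInvarianceBar_iff_dual {B : Matrix D.Idx D.Idx ℂ} :
    D.IsInvarianceBar B ↔ D.dual.IsInvariance Bᵀ := by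
  refine and_congr (by rw [det_transpose]) (forall₂_congr fun z _ => ?_)
  rw [poleDbar_eq_transpose]
  exact (commute_transpose_iff (A := B) (B := (D.dual.poleD z)ᵀ)).symm

theorem IsInvarianceBar.commute_jordanBar {B : Matrix D.Idx D.Idx ℂ} (h : D.IsInvarianceBar B) :
    Commute D.jordanBar B :=
  commute_transpose_iff.1 (isInvariance_iff.1 (isInvarianceBar_iff_dual.1 h)).2

variable {p pbar p' pbar' : D.Vecs N} {B Bbar : Matrix D.Idx D.Idx ℂ}

theorem InvarianceRelated.dual (h : InvarianceRelated p pbar p' pbar') :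
    InvarianceRelated (D := D.dual) pbar p pbar' p' := by
  obtain ⟨B, Bbar, hB, hBbar, hp, hpbar⟩ := h
  exact ⟨Bbarᵀ, Bᵀ, isInvarianceBar_iff_dual.1 hBbar,
    isInvarianceBar_iff_dual.2 (transpose_transpose B ▸ hB),
    (congrArg transpose hpbar).trans (transpose_mul _ _),
    (congrArg transpose hp).trans (transpose_mul _ _)⟩

theorem eq_matKbar {Y : Matrix D.Idx D.Idx ℂ}
    (h : Y * D.jordan - D.jordanBar * Y = rows pbar * cols p) : Y = matKbar p pbar := by
  refine sub_eq_zero.1 (eq_zero_of_semiconjBy_of_isCoprime_charpoly isCoprime_charpoly ?_)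
  rw [SemiconjBy, ← sub_eq_zero, sub_mul, mul_sub, sub_sub_sub_comm, h, matKbar_sylvester, sub_self]

theorem matKbar_eq_mul (hB : Commute D.jordan B) (hBbar : Commute D.jordanBar Bbar)
    (hp : cols p' = cols p * B) (hpbar : rows pbar' = Bbar * rows pbar) :
    matKbar p' pbar' = Bbar * matKbar p pbar * B := by
  refine (eq_matKbar ?_).symm
  calc Bbar * matKbar p pbar * B * D.jordan - D.jordanBar * (Bbar * matKbar p pbar * B)
      = Bbar * matKbar p pbar * (B * D.jordan) - D.jordanBar * Bbar * matKbar p pbar * B := by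
        simp only [Matrix.mul_assoc]
    _ = Bbar * (matKbar p pbar * D.jordan - D.jordanBar * matKbar p pbar) * B := by
        rw [← hB.eq, hBbar.eq]
        simp only [Matrix.mul_sub, Matrix.sub_mul, Matrix.mul_assoc]
    _ = rows pbar' * cols p' := by
        rw [matKbar_sylvester, hp, hpbar]
        simp only [Matrix.mul_assoc]

theorem IsDressing.of_invarianceRelated {G : ℂ → Matrix (Fin N) (Fin N) ℂ}
    (h : IsDressing G p pbar) (hr : InvarianceRelated p pbar p' pbar') :
    IsDressing G p' pbar' := by
  obtain ⟨B, Bbar, hB, hBbar, hp, hpbar⟩ := hr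
  have hK := matKbar_eq_mul (isInvariance_iff.1 hB).2 hBbar.commute_jordanBar hp hpbar
  refine ⟨?_, fun z hz => ?_⟩
  · rw [hK, det_mul, det_mul]
    exact (hBbar.1.mul h.isUnit_Kbar).mul hB.1
  · rw [h.eq_soliton z hz, hK, hp, hpbar, Matrix.mul_inv_rev, Matrix.mul_inv_rev, sub_right_inj]
    symm
    calc cols p * B * (B⁻¹ * ((matKbar p pbar)⁻¹ * Bbar⁻¹)) * D.poleDbar z * (Bbar * rows pbar)
        = cols p * (B * B⁻¹) * (matKbar p pbar)⁻¹ * (Bbar⁻¹ * (D.poleDbar z * Bbar)) *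
            rows pbar := by simp only [Matrix.mul_assoc]
      _ = cols p * (matKbar p pbar)⁻¹ * D.poleDbar z * rows pbar := by
          rw [mul_nonsing_inv _ hB.1, Matrix.mul_one, ← hBbar.2 z hz,
            nonsing_inv_mul_cancel_left _ _ hBbar.1]

end Invariance

namespace IsPVectors

variable {G Ginv : ℂ → Matrix (Fin N) (Fin N) ℂ} {p pbar p' pbar' : D.Vecs N}

theorem isDressing (h : IsPVectors G Ginv p pbar) : IsDressing G p pbar :=
  (isPVectors_iff.1 h).1

theorem dual (h : IsPVectors G Ginv p pbar) :
    IsPVectors (D := D.dual) (fun z => (Ginv z)ᵀ) (fun z => (G z)ᵀ) pbar p :=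
  isPVectors_iff.2 (isPVectors_iff.1 h).symm

theorem kernelEq (h : IsPVectors G Ginv p pbar) : KernelEq G p :=
  h.isDressing.kernelEq

theorem kernelEqBar (h : IsPVectors G Ginv p pbar) : KernelEqBar Ginv pbar :=
  (kernelEqBar_iff_dual _ _).2 h.dual.kernelEq

theorem of_invarianceRelated (h : IsPVectors G Ginv p pbar)
    (hr : InvarianceRelated p pbar p' pbar') : IsPVectors G Ginv p' pbar' :=
  isPVectors_iff.2
    ⟨h.isDressing.of_invarianceRelated hr, h.dual.isDressing.of_invarianceRelated hr.dual⟩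

theorem invarianceRelated_of_kernelEq (h : IsPVectors G Ginv p pbar) (hker : KernelEq G p')
    (hkerbar : KernelEqBar Ginv pbar') (hdet : IsUnit (matKbar p' pbar').det) :
    InvarianceRelated p pbar p' pbar' := by
  obtain ⟨B, hB, hp⟩ := (h.isDressing.kernelEq_iff p').1 hker
  obtain ⟨B', hB', hpbar⟩ :=
    (h.dual.isDressing.kernelEq_iff pbar').1 ((kernelEqBar_iff_dual _ _).1 hkerbar)
  have hrows : rows pbar' = B'ᵀ * rows pbar :=
    (congrArg transpose hpbar).trans (transpose_mul _ _)
  rw [matKbar_eq_mul hB (commute_transpose_iff.2 hB') hp hrows, det_mul, det_mul, IsUnit.mul_iff,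
    IsUnit.mul_iff, det_transpose] at hdet
  exact ⟨B, B'ᵀ, isInvariance_iff.2 ⟨hdet.2, hB⟩,
    isInvarianceBar_iff_dual.2 (isInvariance_iff.2 ⟨hdet.1.1, hB'⟩), hp, hrows⟩

end IsPVectors

/-- A family of soliton matrices `G`, with inverses `Ginv`, for the zeros and blocks `D`, that
solves the linear problems with the potentials `U`, `V`. The linear problems are required only off
both sets of zeros, which makes the notion invariant under `D ↦ D.dual`. -/
structure IsSolitonFamily (D : ZeroData) (lam om : Matrix (Fin N) (Fin N) ℂ[X])
    (G Ginv : ℝ → ℝ → ℂ → Matrix (Fin N) (Fin N) ℂ)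
    (U V : ℝ → ℝ → Matrix (Fin N) (Fin N) ℂ[X]) : Prop where
  exists_isPVectors : ∀ x t, ∃ p pbar : D.Vecs N, IsPVectors (G x t) (Ginv x t) p pbar
  mul_eq_one : ∀ x t z, z ∉ Set.range D.k → z ∉ Set.range D.kbar → G x t z * Ginv x t z = 1
  hasDerivAt_x : ∀ x t z, z ∉ Set.range D.k → z ∉ Set.range D.kbar → ∀ a b,
    HasDerivAt (fun y => G y t z a b)
      ((G x t z * evalM lam z + evalM (U x t) z * G x t z) a b) x
  hasDerivAt_t : ∀ x t z, z ∉ Set.range D.k → z ∉ Set.range D.kbar → ∀ a b,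
    HasDerivAt (fun τ => G x τ z a b)
      ((G x t z * evalM om z + evalM (V x t) z * G x t z) a b) t

theorem PartialDiff.hasDerivAt_cols_x {v : ℝ → ℝ → D.Vecs N} (h : PartialDiff v) (x t : ℝ) :
    HasDerivAt (fun y => cols (v y t)) (cols (dx v x t)) x :=
  hasDerivAt_matrix.2 fun a i => (h x t i a).1.hasDerivAt

theorem PartialDiff.hasDerivAt_cols_t {v : ℝ → ℝ → D.Vecs N} (h : PartialDiff v) (x t : ℝ) :
    HasDerivAt (fun τ => cols (v x τ)) (cols (dt v x t)) t :=
  hasDerivAt_matrix.2 fun a i => (h x t i a).2.hasDerivAt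

theorem EvolutionEq.derivedEq {lam om : Matrix (Fin N) (Fin N) ℂ[X]} {v : ℝ → ℝ → D.Vecs N}
    (h : EvolutionEq lam om v) (G : ℝ → ℝ → ℂ → Matrix (Fin N) (Fin N) ℂ) :
    DerivedEq lam om G v := fun x t ν => by
  rw [(h x t ν).1, (h x t ν).2, mulVec_zero]
  exact ⟨rfl, rfl⟩

theorem hasDerivAt_transpose_inverse {lam : Matrix (Fin N) (Fin N) ℂ[X]}
    {G Ginv : ℝ → Matrix (Fin N) (Fin N) ℂ} {U : Matrix (Fin N) (Fin N) ℂ[X]} {x : ℝ} {z : ℂ}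
    (hinv : ∀ y, G y * Ginv y = 1)
    (hG : ∀ a b, HasDerivAt (fun y => G y a b)
      ((G x * evalM lam z + evalM U z * G x) a b) x) (a b : Fin N) :
    HasDerivAt (fun y => (Ginv y)ᵀ a b)
      (((Ginv x)ᵀ * evalM (-lamᵀ) z + evalM (-Uᵀ) z * (Ginv x)ᵀ) a b) x := by
  have hderiv := hasDerivAt_matrix.1 (hasDerivAt_matrix_inverse hinv (hasDerivAt_matrix.2 hG)) b a
  have hinv' : Ginv x * G x = 1 := mul_eq_one_comm.1 (hinv x)
  have hvalue : (Ginv x)ᵀ * evalM (-lamᵀ) z + evalM (-Uᵀ) z * (Ginv x)ᵀ =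
      (-(Ginv x * (G x * evalM lam z + evalM U z * G x) * Ginv x))ᵀ := by
    calc (Ginv x)ᵀ * evalM (-lamᵀ) z + evalM (-Uᵀ) z * (Ginv x)ᵀ
        = (-(evalM lam z * Ginv x + Ginv x * evalM U z))ᵀ := by
          rw [evalM_neg_transpose, evalM_neg_transpose, transpose_neg, transpose_add,
            transpose_mul, transpose_mul, mul_neg, neg_mul, neg_add]
      _ = (-(Ginv x * (G x * evalM lam z + evalM U z * G x) * Ginv x))ᵀ := by
          rw [mul_add, add_mul, ← mul_assoc, hinv', one_mul, mul_assoc, mul_assoc, hinv x, mul_one]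
  rw [hvalue]
  exact hderiv

namespace IsSolitonFamily

variable {lam om : Matrix (Fin N) (Fin N) ℂ[X]} {G Ginv : ℝ → ℝ → ℂ → Matrix (Fin N) (Fin N) ℂ}
  {U V : ℝ → ℝ → Matrix (Fin N) (Fin N) ℂ[X]}

theorem dual (h : IsSolitonFamily D lam om G Ginv U V) :
    IsSolitonFamily D.dual (-lamᵀ) (-omᵀ) (fun x t z => (Ginv x t z)ᵀ) (fun x t z => (G x t z)ᵀ)
      (fun x t => -(U x t)ᵀ) (fun x t => -(V x t)ᵀ) where
  exists_isPVectors x t :=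
    let ⟨p, pbar, hp⟩ := h.exists_isPVectors x t
    ⟨pbar, p, hp.dual⟩
  mul_eq_one x t z hk hkbar := by
    rw [← transpose_mul, h.mul_eq_one x t z hkbar hk, transpose_one]
  hasDerivAt_x x t z hk hkbar := hasDerivAt_transpose_inverse
    (fun y => h.mul_eq_one y t z hkbar hk) (h.hasDerivAt_x x t z hkbar hk)
  hasDerivAt_t x t z hk hkbar := hasDerivAt_transpose_inverse
    (fun τ => h.mul_eq_one x τ z hkbar hk) (h.hasDerivAt_t x t z hkbar hk)

section LaxFamilies

variable {p pbar : ℝ → ℝ → D.Vecs N}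

theorem isLaxFamily_x (h : IsSolitonFamily D lam om G Ginv U V)
    (hp : ∀ x t, IsPVectors (G x t) (Ginv x t) (p x t) (pbar x t)) (t : ℝ) :
    IsLaxFamily (Fintype.card D.Idx) lam (fun x => numerator (p x t) (pbar x t))
      (fun x => U x t) :=
  isLaxFamily_numerator (fun x => (hp x t).isDressing) fun x => h.hasDerivAt_x x t

theorem isLaxFamily_t (h : IsSolitonFamily D lam om G Ginv U V)
    (hp : ∀ x t, IsPVectors (G x t) (Ginv x t) (p x t) (pbar x t)) (x : ℝ) :
    IsLaxFamily (Fintype.card D.Idx) om (fun t => numerator (p x t) (pbar x t)) (V x) :=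
  isLaxFamily_numerator (fun t => (hp x t).isDressing) fun t => h.hasDerivAt_t x t

theorem derivedEq (h : IsSolitonFamily D lam om G Ginv U V)
    (hp : ∀ x t, IsPVectors (G x t) (Ginv x t) (p x t) (pbar x t)) (hdiff : PartialDiff p) :
    DerivedEq lam om G p := by
  have hzero (x t : ℝ) : polyAct D.jordan (numerator (p x t) (pbar x t)) (cols (p x t)) = 0 :=
    ((hp x t).isDressing.kernelEq_iff_polyAct _).1 (hp x t).kernelEq
  refine fun x t ν => ⟨((hp x t).isDressing.forall_bracket_iff lam _ _).2 ?_ ν,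
    ((hp x t).isDressing.forall_bracket_iff om _ _).2 ?_ ν⟩
  · exact (h.isLaxFamily_x hp t).polyAct_derivative_eq_zero D.jordan (P := fun y => cols (p y t))
      (hdiff.hasDerivAt_cols_x x t) fun y => hzero y t
  · exact (h.isLaxFamily_t hp x).polyAct_derivative_eq_zero D.jordan (P := fun τ => cols (p x τ))
      (hdiff.hasDerivAt_cols_t x t) fun τ => hzero x τ

theorem derivedEqBar (h : IsSolitonFamily D lam om G Ginv U V)
    (hp : ∀ x t, IsPVectors (G x t) (Ginv x t) (p x t) (pbar x t)) (hdiff : PartialDiff pbar) :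
    DerivedEqBar lam om Ginv pbar :=
  (derivedEqBar_iff_dual lam om Ginv pbar).2 (h.dual.derivedEq (fun x t => (hp x t).dual) hdiff)

end LaxFamilies

theorem kernelEq_of_derivedEq (h : IsSolitonFamily D lam om G Ginv U V) {v : ℝ → ℝ → D.Vecs N}
    (hv : PartialDiff v) (hd : DerivedEq lam om G v) {x₀ t₀ : ℝ}
    (h₀ : KernelEq (G x₀ t₀) (v x₀ t₀)) (x t : ℝ) : KernelEq (G x t) (v x t) := by
  choose p pbar hp using h.exists_isPVectors
  have hiff (x t : ℝ) := (hp x t).isDressing.kernelEq_iff_polyAct (v x t)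
  have hx : KernelEq (G x t₀) (v x t₀) := (hiff x t₀).2 <|
    (h.isLaxFamily_x hp t₀).polyAct_eq_zero D.jordan (P := fun y => cols (v y t₀))
      (fun y => hv.hasDerivAt_cols_x y t₀)
      (fun y => ((hp y t₀).isDressing.forall_bracket_iff lam _ _).1 fun ν => (hd y t₀ ν).1)
      ((hiff x₀ t₀).1 h₀) x
  exact (hiff x t).2 <|
    (h.isLaxFamily_t hp x).polyAct_eq_zero D.jordan (P := fun τ => cols (v x τ))
      (fun τ => hv.hasDerivAt_cols_t x τ)
      (fun τ => ((hp x τ).isDressing.forall_bracket_iff om _ _).1 fun ν => (hd x τ ν).2)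
      ((hiff x t₀).1 hx) t

theorem kernelEqBar_of_derivedEqBar (h : IsSolitonFamily D lam om G Ginv U V)
    {v : ℝ → ℝ → D.Vecs N} (hv : PartialDiff v) (hd : DerivedEqBar lam om Ginv v) {x₀ t₀ : ℝ}
    (h₀ : KernelEqBar (Ginv x₀ t₀) (v x₀ t₀)) (x t : ℝ) : KernelEqBar (Ginv x t) (v x t) :=
  (kernelEqBar_iff_dual _ _).2 <| h.dual.kernelEq_of_derivedEq hv
    ((derivedEqBar_iff_dual lam om Ginv v).1 hd) ((kernelEqBar_iff_dual _ _).1 h₀) x t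

theorem kernelEq_evolve (h : IsSolitonFamily D lam om G Ginv U V) (hcomm : Commute lam om)
    (p0 : D.Vecs N) {x₀ t₀ : ℝ} (h₀ : KernelEq (G x₀ t₀) (evolve lam om p0 x₀ t₀)) (x t : ℝ) :
    KernelEq (G x t) (evolve lam om p0 x t) :=
  h.kernelEq_of_derivedEq (partialDiff_evolve hcomm p0)
    ((evolutionEq_evolve hcomm p0).derivedEq G) h₀ x t

variable {p0 pbar0 p pbar : D.Vecs N} {x t : ℝ}

theorem exists_cols_evolve_eq_mul (h : IsSolitonFamily D lam om G Ginv U V)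
    (hcomm : Commute lam om) (h0 : IsPVectors (G 0 0) (Ginv 0 0) p0 pbar0)
    (hp : IsPVectors (G x t) (Ginv x t) p pbar) :
    ∃ B, D.IsInvariance B ∧ cols (evolve lam om p0 x t) = cols p * B := by
  obtain ⟨B, hB, hforward⟩ : ∃ B, Commute D.jordan B ∧
      cols (evolve lam om p0 x t) = cols p * B :=
    (hp.isDressing.kernelEq_iff _).1 <|
      h.kernelEq_evolve hcomm p0 ((evolve_zero p0).symm ▸ h0.kernelEq) x t
  obtain ⟨B', hB', hbackward⟩ : ∃ B', Commute D.jordan B' ∧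
      cols (evolve lam om p (-x) (-t)) = cols p0 * B' := by
    refine (h0.isDressing.kernelEq_iff _).1 ?_
    have hker := h.kernelEq_evolve hcomm (evolve lam om p (-x) (-t)) (x₀ := x) (t₀ := t)
      ((evolve_evolve_neg p x t).symm ▸ hp.kernelEq) 0 0
    rwa [evolve_zero] at hker
  have hreturn : cols p = cols p * (B * B') := by
    rw [← Matrix.mul_assoc, ← hforward, ← cols_evolve_eq_mul hB' hbackward, evolve_evolve_neg]
  have hinverse : 1 - B * B' = 0 := by
    refine eq_zero_of_mul_eq_zero_of_commute isCoprime_charpoly hp.isUnit_Kbar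
      (matKbar_sylvester p pbar) ((Commute.one_right _).sub_right (hB.mul_right hB')) ?_
    rw [Matrix.mul_sub, Matrix.mul_one, ← hreturn, sub_self]
  exact ⟨B, isInvariance_iff.2 ⟨isUnit_det_of_right_inverse (sub_eq_zero.1 hinverse).symm, hB⟩,
    hforward⟩

theorem isPVectors_evolve (h : IsSolitonFamily D lam om G Ginv U V) (hcomm : Commute lam om)
    (h0 : IsPVectors (G 0 0) (Ginv 0 0) p0 pbar0) (x t : ℝ) :
    IsPVectors (G x t) (Ginv x t) (evolve lam om p0 x t) (evolveBar lam om pbar0 x t) := by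
  obtain ⟨p, pbar, hp⟩ := h.exists_isPVectors x t
  obtain ⟨B, hB, hcols⟩ := h.exists_cols_evolve_eq_mul hcomm h0 hp
  obtain ⟨B', hB', hrows⟩ :=
    h.dual.exists_cols_evolve_eq_mul (commute_neg_transpose hcomm) h0.dual hp.dual
  refine hp.of_invarianceRelated ⟨B, B'ᵀ, hB, isInvarianceBar_iff_dual.2 hB', hcols, ?_⟩
  rw [evolveBar_eq_dual]
  exact (congrArg transpose hrows).trans (transpose_mul _ _)

end IsSolitonFamily

end ZeroData

end Soliton

theorem mainTheorem6 (N : ℕ) (D : Soliton.ZeroData)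
    (lam om : Matrix (Fin N) (Fin N) (Polynomial ℂ)) (hcomm : Commute lam om)
    (G Ginv : ℝ → ℝ → ℂ → Matrix (Fin N) (Fin N) ℂ)
    (U V : ℝ → ℝ → Matrix (Fin N) (Fin N) (Polynomial ℂ))
    (hinv : ∀ x t z, z ∉ Set.range D.k → z ∉ Set.range D.kbar → G x t z * Ginv x t z = 1)
    (hsol : ∀ x t, ∃ p pbar : D.Vecs N, Soliton.ZeroData.IsPVectors (G x t) (Ginv x t) p pbar)
    (hx : ∀ x t z, z ∉ Set.range D.kbar → ∀ a b,
      HasDerivAt (fun y => G y t z a b)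
        ((G x t z * Soliton.evalM lam z + Soliton.evalM (U x t) z * G x t z) a b) x)
    (ht : ∀ x t z, z ∉ Set.range D.kbar → ∀ a b,
      HasDerivAt (fun τ => G x τ z a b)
        ((G x t z * Soliton.evalM om z + Soliton.evalM (V x t) z * G x t z) a b) t) :
    -- the derived equations hold for all p-vectors that depend differentiably on `x` and `t`
    (∀ p pbar : ℝ → ℝ → D.Vecs N,
      (∀ x t, Soliton.ZeroData.IsPVectors (G x t) (Ginv x t) (p x t) (pbar x t)) →
      (Soliton.ZeroData.PartialDiff p → Soliton.ZeroData.DerivedEq lam om G p) ∧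
      (Soliton.ZeroData.PartialDiff pbar → Soliton.ZeroData.DerivedEqBar lam om Ginv pbar)) ∧
    -- the evolution equations are solved precisely by the exponentials
    (∀ p : ℝ → ℝ → D.Vecs N,
      (Soliton.ZeroData.PartialDiff p ∧ Soliton.ZeroData.EvolutionEq lam om p) ↔
        ∃ p0 : D.Vecs N, ∀ x t, p x t = Soliton.ZeroData.evolve lam om p0 x t) ∧
    (∀ pbar : ℝ → ℝ → D.Vecs N,
      (Soliton.ZeroData.PartialDiff pbar ∧ Soliton.ZeroData.EvolutionEqBar lam om pbar) ↔
        ∃ pbar0 : D.Vecs N, ∀ x t, pbar x t = Soliton.ZeroData.evolveBar lam om pbar0 x t) ∧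
    -- no loss of generality
    (∀ p0 pbar0 : D.Vecs N, Soliton.ZeroData.IsPVectors (G 0 0) (Ginv 0 0) p0 pbar0 →
      -- the exponentially evolving vectors are p-vectors of the soliton matrix for all `x`, `t`
      (∀ x t, Soliton.ZeroData.IsPVectors (G x t) (Ginv x t)
        (Soliton.ZeroData.evolve lam om p0 x t) (Soliton.ZeroData.evolveBar lam om pbar0 x t)) ∧
      -- all p-vectors are related to them by invariance transformations
      (∀ x t (p pbar : D.Vecs N), Soliton.ZeroData.IsPVectors (G x t) (Ginv x t) p pbar →
        Soliton.ZeroData.InvarianceRelated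
          (Soliton.ZeroData.evolve lam om p0 x t) (Soliton.ZeroData.evolveBar lam om pbar0 x t)
          p pbar) ∧
      -- and so are all non-degenerate solutions of the derived equations
      (∀ p pbar : ℝ → ℝ → D.Vecs N,
        Soliton.ZeroData.PartialDiff p → Soliton.ZeroData.PartialDiff pbar →
        Soliton.ZeroData.KernelEq (G 0 0) (p 0 0) →
        Soliton.ZeroData.KernelEqBar (Ginv 0 0) (pbar 0 0) →
        Soliton.ZeroData.DerivedEq lam om G p → Soliton.ZeroData.DerivedEqBar lam om Ginv pbar →
        (∀ x t, IsUnit (Soliton.ZeroData.matKbar (p x t) (pbar x t)).det ∧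
          IsUnit (Soliton.ZeroData.matK (p x t) (pbar x t)).det) →
        ∀ x t,
          Soliton.ZeroData.InvarianceRelated
            (Soliton.ZeroData.evolve lam om p0 x t) (Soliton.ZeroData.evolveBar lam om pbar0 x t)
            (p x t) (pbar x t) ∧
          Soliton.ZeroData.IsPVectors (G x t) (Ginv x t) (p x t) (pbar x t))) ∧
    -- the exponentials are the block-Toeplitz matrices of the derivatives of `E` and `E⁻¹`
    (∀ x t (ν : D.Block),
      Soliton.ZeroData.propagator lam om x t ν =
        Soliton.lowerToeplitz (D.size ν) (Soliton.expE lam om x t) (D.κ ν) ∧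
      Soliton.ZeroData.propagatorBar lam om x t ν =
        Soliton.upperToeplitz (D.size ν) (fun z => (Soliton.expE lam om x t z)⁻¹) (D.κbar ν)) := by
  have h : Soliton.ZeroData.IsSolitonFamily D lam om G Ginv U V :=
    ⟨hsol, hinv, fun x t z _ => hx x t z, fun x t z _ => ht x t z⟩
  refine ⟨fun p pbar hp => ⟨h.derivedEq hp, h.derivedEqBar hp⟩,
    Soliton.ZeroData.evolution_iff hcomm, Soliton.ZeroData.evolutionBar_iff hcomm,
    fun p0 pbar0 h0 => ?_, fun x t ν =>
      ⟨Soliton.ZeroData.propagator_eq_lowerToeplitz lam om x t ν,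
        Soliton.ZeroData.propagatorBar_eq_upperToeplitz lam om x t ν⟩⟩
  have hev := h.isPVectors_evolve hcomm h0
  refine ⟨hev, fun x t p pbar hp =>
    (hev x t).invarianceRelated_of_kernelEq hp.kernelEq hp.kernelEqBar hp.isUnit_Kbar, ?_⟩
  intro p pbar hdiff hdiffbar hker hkerbar hd hdbar hdet x t
  have hrel := (hev x t).invarianceRelated_of_kernelEq
    (h.kernelEq_of_derivedEq hdiff hd hker x t)
    (h.kernelEqBar_of_derivedEqBar hdiffbar hdbar hkerbar x t) (hdet x t).1
  exact ⟨hrel, (hev x t).of_invarianceRelated hrel⟩
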